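/- Let $\mathbf U$ be a unipotent algebraic group over $\mathbb Q$, i.e. an affine group scheme of finite type over $\mathbb Q$ such that every nonzero linear representation of $\mathbf U$ has a nonzero fixed vector (for example, the unipotent radical of a parabolic $\mathbb Q$-subgroup of an algebraic $\mathbb Q$-group). For each place $\nu\in\{2,3,5,\ldots,\infty\}$ of $\mathbb Q$, with completion $\mathbb Q_\nu$ ($\mathbb Q_\infty=\mathbb R$), let $U_\nu=\mathbf U(\mathbb Q_\nu)$, let $\mathfrak u_\nu$ be the Lie algebra of $U_\nu$, i.e. the $\mathbb Q_\nu$-points of the Lie algebra of $\mathbf U$, and let $\mathfrak u_\nu^*$ be its $\mathbb Q_\nu$-linear dual. Let $\mathfrak u_{\mathbb Q}$ be the Lie algebra of $\mathbf U$ over $\mathbb Q$, so that $\mathfrak u_\nu=\mathbb Q_\nu\otimes_{\mathbb Q}\mathfrak u_{\mathbb Q}$. Let $\mu\in\mathfrak u_{\mathbb Q}^*=\mathrm{Hom}_{\mathbb Q}(\mathfrak u_{\mathbb Q},\mathbb Q)$, let $\mu_\nu\in\mathfrak u_\nu^*$ be the unique $\mathbb Q_\nu$-linear extension of $\mu$,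 and let $\mathcal O_{\mu_\nu}\subseteq\mathfrak u_\nu^*$ be the orbit of $\mu_\nu$ under the coadjoint action of $U_\nu$. Then for every place $\nu$ the orbit $\mathcal O_{\mu_\nu}$ is an analytic $\mathbb Q_\nu$-submanifold of $\mathfrak u_\nu^*$, and its dimension is independent of $\nu$: there is an integer $d\ge 0$ such that, for every $\nu$, around each point of $\mathcal O_{\mu_\nu}$ there is a $\mathbb Q_\nu$-analytic chart of $\mathfrak u_\nu^*$, with analytic inverse, carrying $\mathcal O_{\mu_\nu}$ to a $d$-dimensional linear subspace. -/

import Mathlib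

open scoped TensorProduct

noncomputable section

namespace UnipotentOrbit

universe u

/-! ### Affine algebraic groups over `ℚ`

An affine algebraic group over `ℚ` is given by its coordinate ring `A`, a commutative Hopf algebra
of finite type over `ℚ`. -/

section Unipotent

/-- A linear representation of the affine group with coordinate ring `A` on `V`,
as a right coaction `ρ : V → V ⊗ A`. -/
structure IsCoaction (A : Type u) [CommRing A] [HopfAlgebra ℚ A]
    {V : Type u} [AddCommGroup V] [Module ℚ V] (ρ : V →ₗ[ℚ] V ⊗[ℚ] A) : Prop where
  coassoc : (TensorProduct.assoc ℚ V A A).toLinearMap ∘ₗ ρ.rTensor A ∘ₗ ρ =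
    (Coalgebra.comul (R := ℚ) (A := A)).lTensor V ∘ₗ ρ
  counit : (TensorProduct.rid ℚ V).toLinearMap ∘ₗ
    (Coalgebra.counit (R := ℚ) (A := A)).lTensor V ∘ₗ ρ = LinearMap.id

/-- The affine group with coordinate ring `A` is unipotent: every nonzero linear representation
has a nonzero fixed vector. -/
def IsUnipotent (A : Type u) [CommRing A] [HopfAlgebra ℚ A] : Prop :=
  ∀ (V : Type u) [AddCommGroup V] [Module ℚ V] (ρ : V →ₗ[ℚ] V ⊗[ℚ] A),
    IsCoaction A ρ → Nontrivial V → ∃ v : V, v ≠ 0 ∧ ρ v = v ⊗ₜ[ℚ] (1 : A)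

end Unipotent

section Group

variable (A : Type*) [CommRing A] [HopfAlgebra ℚ A] (K : Type*) [Field K] [Algebra ℚ K]

/-- The group of `K`-points: algebra homomorphisms `A → K`, with the product
`(g h)(a) = ∑ g(a₁) h(a₂)`. -/
def Points : Type _ := WithConv (A →ₐ[ℚ] K)

instance : Monoid (Points A K) := inferInstanceAs (Monoid (WithConv (A →ₐ[ℚ] K)))

variable {A K}

/-- A `K`-point viewed as an element of the convolution algebra of linear maps `A → K`. -/
def Points.toLin (g : Points A K) : WithConv (A →ₗ[ℚ] K) :=
  WithConv.toConv (WithConv.ofConv g).toLinearMap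

theorem Points.toLin_one : (1 : Points A K).toLin = 1 := rfl

theorem Points.toLin_mul (g h : Points A K) : (g * h).toLin = g.toLin * h.toLin := rfl

theorem Points.toLin_injective : Function.Injective (Points.toLin : Points A K → _) := fun _ _ e =>
  WithConv.ext (AlgHom.toLinearMap_injective (congrArg WithConv.ofConv e))

theorem Points.map_mul (g : Points A K) (a b : A) : g.toLin (a * b) = g.toLin a * g.toLin b :=
  _root_.map_mul (WithConv.ofConv g) a b

instance : Inv (Points A K) :=
  ⟨fun g => WithConv.toConv ((WithConv.ofConv g).comp (HopfAlgebra.antipodeAlgHom ℚ A))⟩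

theorem Points.inv_apply (g : Points A K) (a : A) :
    g⁻¹.toLin a = g.toLin (HopfAlgebra.antipode ℚ a) := rfl

theorem Points.inv_mul (g : Points A K) : g⁻¹ * g = 1 := by
  apply Points.toLin_injective
  rw [Points.toLin_mul]
  ext a
  rw [(Coalgebra.Repr.arbitrary ℚ a).convMul_apply]
  simp only [Points.inv_apply, ← Points.map_mul, ← map_sum]
  rw [HopfAlgebra.sum_antipode_mul_eq_algebraMap_counit]
  exact (WithConv.ofConv g).commutes _

instance : Group (Points A K) where
  inv_mul_cancel := Points.inv_mul

variable (A K)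

/-- The `K`-valued derivations of `A` at the identity: the `ℚ`-linear maps `D : A → K` with
`D (a b) = ε(a) D b + ε(b) D a`, where `ε` is the counit. -/
def lieSubmodule : Submodule K (A →ₗ[ℚ] K) where
  carrier := {D | ∀ a b, D (a * b) =
    algebraMap ℚ K (Coalgebra.counit a) * D b + algebraMap ℚ K (Coalgebra.counit b) * D a}
  add_mem' := fun {D E} hD hE a b => by
    simp only [LinearMap.add_apply, hD a b, hE a b]; ring
  zero_mem' := fun a b => by simp
  smul_mem' := fun c D hD a b => by
    simp only [LinearMap.smul_apply, hD a b, smul_eq_mul]; ring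

/-- The Lie algebra of `K`-points, i.e. the tangent space at the identity, as a `K`-vector
space. -/
def LieAlg : Type _ := lieSubmodule A K

instance : AddCommGroup (LieAlg A K) := inferInstanceAs (AddCommGroup (lieSubmodule A K))

instance : Module K (LieAlg A K) := inferInstanceAs (Module K (lieSubmodule A K))

variable {A K}

/-- An element of the Lie algebra as a linear map `A → K`. -/
def LieAlg.toLin : LieAlg A K →ₗ[K] (A →ₗ[ℚ] K) := (lieSubmodule A K).subtype

theorem LieAlg.ext {D E : LieAlg A K} (h : ∀ a, D.toLin a = E.toLin a) : D = E :=
  Subtype.ext (LinearMap.ext h)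

theorem LieAlg.leibniz (D : LieAlg A K) (a b : A) : D.toLin (a * b) =
    algebraMap ℚ K (Coalgebra.counit a) * D.toLin b +
      algebraMap ℚ K (Coalgebra.counit b) * D.toLin a := D.2 a b

theorem mul_leibniz {φ ψ g : Points A K} {D : WithConv (A →ₗ[ℚ] K)}
    (hD : ∀ a b, D (a * b) = φ.toLin a * D b + φ.toLin b * D a) (a b : A) :
    (g.toLin * D * ψ.toLin) (a * b) =
      (g * φ * ψ).toLin a * (g.toLin * D * ψ.toLin) b +
        (g * φ * ψ).toLin b * (g.toLin * D * ψ.toLin) a := by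
  have left : ∀ a b, (g.toLin * D) (a * b) =
      (g * φ).toLin a * (g.toLin * D) b + (g * φ).toLin b * (g.toLin * D) a := by
    intro a b
    let r := Coalgebra.Repr.arbitrary ℚ a
    let s := Coalgebra.Repr.arbitrary ℚ b
    rw [Points.toLin_mul, (r.mul s).convMul_apply, r.convMul_apply, s.convMul_apply,
      r.convMul_apply, s.convMul_apply, Finset.sum_mul_sum, Finset.sum_mul_sum,
      Finset.sum_comm (s := s.index), ← Finset.sum_add_distrib]
    simp only [← Finset.sum_add_distrib]
    refine (Finset.sum_product _ _ _).trans ?_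
    refine Finset.sum_congr rfl fun i _ => Finset.sum_congr rfl fun j _ => ?_
    change g.toLin (r.left i * s.left j) * D (r.right i * s.right j) = _
    rw [Points.map_mul, hD]; ring
  let r := Coalgebra.Repr.arbitrary ℚ a
  let s := Coalgebra.Repr.arbitrary ℚ b
  rw [Points.toLin_mul (g * φ), (r.mul s).convMul_apply, r.convMul_apply, s.convMul_apply,
    r.convMul_apply, s.convMul_apply, Finset.sum_mul_sum, Finset.sum_mul_sum,
    Finset.sum_comm (s := s.index), ← Finset.sum_add_distrib]
  simp only [← Finset.sum_add_distrib]
  refine (Finset.sum_product _ _ _).trans ?_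
  refine Finset.sum_congr rfl fun i _ => Finset.sum_congr rfl fun j _ => ?_
  change (g.toLin * D) (r.left i * s.left j) * ψ.toLin (r.right i * s.right j) = _
  rw [Points.map_mul, left]; ring

theorem conj_mem (g : Points A K) (D : LieAlg A K) :
    (g.toLin * WithConv.toConv D.toLin * g⁻¹.toLin).ofConv ∈ lieSubmodule A K := fun a b => by
  have h := mul_leibniz (φ := 1) (ψ := g⁻¹) (g := g) (D := WithConv.toConv D.toLin) D.leibniz a b
  rw [mul_one, mul_inv_cancel] at h
  exact h

variable (A K)

/-- The adjoint representation `Ad(g) D = g D g⁻¹`, computed in the convolution algebra of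
linear maps `A → K`. -/
def adjointRep : Representation K (Points A K) (LieAlg A K) where
  toFun g := LinearMap.codRestrict (lieSubmodule A K)
    { toFun := fun D => (g.toLin * WithConv.toConv D.toLin * g⁻¹.toLin).ofConv
      map_add' := fun D E => by simp [mul_add, add_mul]
      map_smul' := fun c D => by simp }
    (conj_mem g)
  map_one' := by
    refine LinearMap.ext fun D => Subtype.ext ?_
    change ((1 : Points A K).toLin * WithConv.toConv D.toLin * (1 : Points A K)⁻¹.toLin).ofConv =
      D.toLin
    simp [Points.toLin_one]
  map_mul' g h := by
    refine LinearMap.ext fun D => Subtype.ext ?_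
    change ((g * h).toLin * WithConv.toConv D.toLin * (g * h)⁻¹.toLin).ofConv =
      (g.toLin * (h.toLin * WithConv.toConv D.toLin * h⁻¹.toLin) * g⁻¹.toLin).ofConv
    simp [Points.toLin_mul, mul_assoc]

variable {A K}

theorem adjointRep_toLin (g : Points A K) (D : LieAlg A K) :
    (adjointRep A K g D).toLin = (g.toLin * WithConv.toConv D.toLin * g⁻¹.toLin).ofConv := rfl

/-- The orbit of `l` under the coadjoint action `(Ad*(g) l)(D) = l (Ad(g⁻¹) D)` of the group of
`K`-points on the dual of the Lie algebra of `K`-points. -/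
def coadjointOrbit (l : Module.Dual K (LieAlg A K)) : Set (Module.Dual K (LieAlg A K)) :=
  Set.range fun g : Points A K => (adjointRep A K).dual g l

/-! ### Extension of scalars -/

theorem LieAlg.map_one (D : LieAlg A K) : D.toLin 1 = 0 := by
  have h := D.leibniz 1 1
  simp only [mul_one, Bialgebra.counit_one, _root_.map_one, one_mul] at h
  exact left_eq_add.mp h

theorem LieAlg.mem_span (D : LieAlg A K) {s : Set A} (hs : Algebra.adjoin ℚ s = ⊤) (a : A) :
    D.toLin a ∈ Submodule.span ℚ (D.toLin '' s) := by
  have ha : a ∈ Algebra.adjoin ℚ s := hs ▸ Algebra.mem_top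
  induction ha using Algebra.adjoin_induction with
  | mem x hx => exact Submodule.subset_span ⟨x, hx, rfl⟩
  | algebraMap r =>
    have h : D.toLin (algebraMap ℚ A r) = 0 := by
      rw [Algebra.algebraMap_eq_smul_one, map_smul, LieAlg.map_one]
      rw [Algebra.smul_def, mul_zero]
    rw [h]
    exact zero_mem _
  | add x y _ _ hx hy => rw [map_add]; exact add_mem hx hy
  | mul x y _ _ hx hy =>
    rw [D.leibniz x y, ← Algebra.smul_def, ← Algebra.smul_def]
    exact add_mem (Submodule.smul_mem _ _ hy) (Submodule.smul_mem _ _ hx)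

instance [Algebra.FiniteType ℚ A] : FiniteDimensional K (LieAlg A K) := by
  obtain ⟨s, hs⟩ := (Algebra.FiniteType.out : (⊤ : Subalgebra ℚ A).FG)
  let f : LieAlg A K →ₗ[K] (s → K) :=
    { toFun := fun D i => D.toLin i
      map_add' := fun D E => by ext; simp
      map_smul' := fun c D => by ext; simp }
  have hf : Function.Injective f := LinearMap.ker_eq_bot.1 <| LinearMap.ker_eq_bot'.2 fun D hD => ?_
  exact FiniteDimensional.of_injective f hf
  refine LieAlg.ext fun a => ?_
  have h := LieAlg.mem_span D hs a
  have h0 : D.toLin '' (s : Set A) ⊆ {0} := by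
    rintro _ ⟨x, hx, rfl⟩
    exact congrFun hD ⟨x, hx⟩
  have := Submodule.span_mono (R := ℚ) h0 h
  simpa using this

instance [Algebra.FiniteType ℚ A] : FiniteDimensional K (Module.Dual K (LieAlg A K)) :=
  inferInstance

variable (A K)

instance (priority := 100) : Module ℚ (LieAlg A K) := Module.compHom _ (algebraMap ℚ K)

instance (priority := 100) : IsScalarTower ℚ K (LieAlg A K) := ⟨fun r k D => by
  rw [Algebra.smul_def, mul_smul]; rfl⟩

/-- The inclusion of the Lie algebra of `ℚ`-points in the Lie algebra of `K`-points. -/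
def LieAlg.incl : LieAlg A ℚ →ₗ[ℚ] LieAlg A K where
  toFun D := ⟨Algebra.linearMap ℚ K ∘ₗ D.toLin, fun a b => by
    rw [LinearMap.comp_apply, D.leibniz a b]
    simp only [map_add, map_mul, LinearMap.comp_apply, Algebra.linearMap_apply]
    rfl⟩
  map_add' D E := LieAlg.ext fun a => map_add (algebraMap ℚ K) (D.toLin a) (E.toLin a)
  map_smul' c D := LieAlg.ext fun a => map_mul (algebraMap ℚ K) c (D.toLin a)

theorem LieAlg.incl_toLin (D : LieAlg A ℚ) (a : A) :
    (LieAlg.incl A K D).toLin a = algebraMap ℚ K (D.toLin a) := rfl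

theorem LieAlg.isBaseChange [Algebra.FiniteType ℚ A] : IsBaseChange K (LieAlg.incl A K) := by
  let b := Module.Basis.ofVectorSpace ℚ K
  let F : K ⊗[ℚ] LieAlg A ℚ →ₗ[K] LieAlg A K :=
    TensorProduct.AlgebraTensorModule.lift
      (((LinearMap.toSpanSingleton K (LieAlg A ℚ →ₗ[ℚ] LieAlg A K) (LieAlg.incl A K))))
  have hF : ∀ k D, F (k ⊗ₜ D) = k • LieAlg.incl A K D := fun k D => rfl
  have hFa : ∀ k D a, (F (k ⊗ₜ D)).toLin a = D.toLin a • k := fun k D a => by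
    rw [hF, Algebra.smul_def]; exact mul_comm _ _
  have inj : Function.Injective F := by
    refine (injective_iff_map_eq_zero F).2 fun t ht => ?_
    obtain ⟨c, rfl⟩ := TensorProduct.eq_repr_basis_left b t
    have h0 : c = 0 := by
      refine Finsupp.ext fun i => LieAlg.ext fun a => ?_
      have h1 : (F (c.sum fun i D => b i ⊗ₜ[ℚ] D)).toLin a = c.sum fun i D => D.toLin a • b i := by
        simp [Finsupp.sum, map_sum, hFa]
      have h2 : c.sum (fun i D => D.toLin a • b i) =
          Finsupp.linearCombination ℚ b (c.mapRange (fun D => D.toLin a) (by simp)) := by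
        rw [Finsupp.linearCombination_apply, Finsupp.sum_mapRange_index fun i => zero_smul ℚ (b i)]
      rw [ht, h2] at h1
      have h3 := linearIndependent_iff.1 b.linearIndependent _ h1.symm
      exact DFunLike.congr_fun h3 i
    simp [h0]
  have surj : Function.Surjective F := by
    intro D
    obtain ⟨s, hs⟩ := (Algebra.FiniteType.out : (⊤ : Subalgebra ℚ A).FG)
    classical
    let T : Finset _ := s.biUnion fun x => (b.repr (D.toLin x)).support
    let E : ∀ i, LieAlg A ℚ := fun i =>
      ⟨b.coord i ∘ₗ D.toLin, fun x y => by
        have := D.leibniz x y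
        simp only [LinearMap.comp_apply, this, map_add, ← Algebra.smul_def, map_smul]⟩
    refine ⟨∑ i ∈ T, b i ⊗ₜ[ℚ] E i, LieAlg.ext fun a => ?_⟩
    have hsupp : (b.repr (D.toLin a)).support ⊆ T := by
      have h1 : Submodule.span ℚ (D.toLin '' (s : Set A)) ≤
          (Finsupp.supported ℚ ℚ (T : Set _)).comap b.repr.toLinearMap := by
        rw [Submodule.span_le]
        rintro _ ⟨x, hx, rfl⟩
        intro i hi
        exact Finset.mem_coe.2 (Finset.mem_biUnion.2 ⟨x, hx, hi⟩)
      exact fun i hi => Finset.mem_coe.1 (h1 (LieAlg.mem_span D hs a) hi)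
    have h2 : (F (∑ i ∈ T, b i ⊗ₜ[ℚ] E i)).toLin a = ∑ i ∈ T, b.repr (D.toLin a) i • b i := by
      rw [map_sum, map_sum, LinearMap.sum_apply]
      exact Finset.sum_congr rfl fun i _ => hFa (b i) (E i) a
    rw [h2]
    conv_rhs => rw [← b.linearCombination_repr (D.toLin a)]
    rw [Finsupp.linearCombination_apply]
    exact (Finsupp.sum_of_support_subset _ hsupp (fun i r => r • b i)
      fun i _ => zero_smul ℚ (b i)).symm
  exact IsBaseChange.of_equiv (LinearEquiv.ofBijective F ⟨inj, surj⟩) fun D =>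
    (hF 1 D).trans (one_smul K _)

variable {A}

/-- The canonical extension of a rational functional: the unique `K`-linear functional on the
Lie algebra of `K`-points that restricts to `μ` on the Lie algebra of `ℚ`-points. -/
def extend [Algebra.FiniteType ℚ A] (μ : Module.Dual ℚ (LieAlg A ℚ)) :
    Module.Dual K (LieAlg A K) :=
  (LieAlg.isBaseChange A K).lift (Algebra.linearMap ℚ K ∘ₗ μ)

theorem extend_incl [Algebra.FiniteType ℚ A] (μ : Module.Dual ℚ (LieAlg A ℚ)) (D : LieAlg A ℚ) :
    extend K μ (LieAlg.incl A K D) = algebraMap ℚ K (μ D) :=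
  (LieAlg.isBaseChange A K).lift_eq _ D

end Group

/-! ### Analytic submanifolds -/

section Submanifold

variable (K : Type*) [NontriviallyNormedField K]

/-- `S` is an analytic submanifold, everywhere of dimension `d`, of the normed space `E`: around
each of its points there is an analytic chart of `E`, with analytic inverse, that carries `S` to a
`d`-dimensional linear subspace. -/
def IsAnalyticSubmanifoldOfNormed {E : Type*} [NormedAddCommGroup E] [NormedSpace K E]
    (S : Set E) (d : ℕ) : Prop :=
  ∀ x ∈ S, ∃ φ : OpenPartialHomeomorph E E, x ∈ φ.source ∧
    AnalyticOnNhd K φ φ.source ∧ AnalyticOnNhd K φ.symm φ.target ∧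
    ∃ W : Submodule K E, Module.finrank K W = d ∧ φ '' (φ.source ∩ S) = φ.target ∩ W

/-- `S` is an analytic submanifold, everywhere of dimension `d`, of the finite-dimensional vector
space `V` with its canonical topology and analytic structure, which are read off in linear
coordinates. -/
def IsAnalyticSubmanifold {V : Type*} [AddCommGroup V] [Module K V] [FiniteDimensional K V]
    (S : Set V) (d : ℕ) : Prop :=
  ∀ (n : ℕ) (e : V ≃ₗ[K] (Fin n → K)), IsAnalyticSubmanifoldOfNormed K (e '' S) d

end Submanifold

end UnipotentOrbit

end

noncomputable section

namespace UnipotentOrbit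

/-! ### Flags, adapted projections and truncated exponentials -/

section Flag

variable {K V : Type*} [Field K] [AddCommGroup V] [Module K V]

/-! Over a field of characteristic zero a unipotent group is the exponential of its Lie algebra, so
a coadjoint orbit is the orbit of a group of exponentials of nilpotent operators. Such an orbit is
the graph of an analytic map over its tangent space at the base point.

Algebraic side. Unipotence exhausts the coordinate ring by iterated fixed vectors of the regular
representation (`exists_mem_socle`). Hence a product of many functionals vanishing at `1` kills any
given element, and exponential series in the convolution algebra are finite at each point. The
exponential is surjective: the values of `g ^ n` at a fixed element are polynomial in `n`, and the
linear coefficient of this polynomial is a logarithm (`Points.exp_log`). Moreover Ad(exp X) = exp(ad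
X) (`adjointRep_exp`), and `ad` is nilpotent.

Analytic side (`isAnalyticSubmanifoldOfNormed_orbit`). Let T be the tangent space of the orbit of v,
and π a projection onto T that respects the flag along which the Lie algebra acts nilpotently. A
finite iteration builds an analytic map f with values in the orbit, with f ∘ π = f and π ∘ f = π,
which fixes every point of the orbit. The orbit is then the image of f and has dimension dim T.

Independence of the place. For the extension of μ, T is the image of X ↦ μ ∘ ad X. This map is the
scalar extension of the same map over ℚ, so its rank is the rank over ℚ (`finrank_range_extend`). -/

theorem exists_complement_adapted (T : Submodule K V) (N : ℕ) :
    ∀ F : ℕ → Submodule K V, Antitone F → F N = ⊥ →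
      ∃ C : Submodule K V, Disjoint C T ∧ ∀ j, F j ≤ (C ⊓ F j) ⊔ (T ⊓ F j) := by
  induction N with
  | zero =>
    intro F hF h0
    exact ⟨⊥, disjoint_bot_left, fun j => (hF (Nat.zero_le j)).trans (h0.le.trans bot_le)⟩
  | succ N ih =>
    intro F hF hN
    obtain ⟨C', hd, hC'⟩ := ih (fun j => F (j + 1)) (fun i j h => hF (by omega)) hN
    have hd' : Disjoint (C' ⊓ F 1) (T ⊓ F 0) := hd.mono inf_le_left inf_le_left
    -- The induction treats the flag shifted by one. The part of `C'` inside `F 1` is enlarged to a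
    -- complement of `T ⊓ F 0`; cutting it back to `F 0` then makes it disjoint from all of `T`.
    obtain ⟨C₁, hle, hc⟩ := hd'.exists_isCompl
    have hle' : C' ⊓ F 1 ≤ C₁ ⊓ F 0 := le_inf hle (inf_le_right.trans (hF (Nat.zero_le 1)))
    refine ⟨C₁ ⊓ F 0, ?_, ?_⟩
    · rw [disjoint_iff, eq_bot_iff, ← hc.inf_eq_bot]
      exact le_inf (inf_le_left.trans inf_le_left)
        (le_inf inf_le_right (inf_le_left.trans inf_le_right))
    · rintro (_ | j)
      · intro x hx
        obtain ⟨c, hcC, t, ht, rfl⟩ := Submodule.mem_sup.1 (hc.sup_eq_top ▸ Submodule.mem_top :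
          x ∈ C₁ ⊔ (T ⊓ F 0))
        have : c ∈ F 0 := by simpa using sub_mem hx ht.2
        exact Submodule.add_mem_sup ⟨⟨hcC, this⟩, this⟩ ht
      · refine (hC' j).trans (sup_le_sup_right (le_inf (le_trans ?_ hle') inf_le_right) _)
        exact inf_le_inf_left _ (hF (by omega))

/-- A subspace has a linear projection that preserves the terms of a given finite flag. -/
theorem exists_projection_adapted (T : Submodule K V) {F : ℕ → Submodule K V} (hF : Antitone F)
    (h0 : F 0 = ⊤) {N : ℕ} (hN : F N = ⊥) :
    ∃ π : V →ₗ[K] V, LinearMap.range π = T ∧ (∀ t ∈ T, π t = t) ∧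
      ∀ i, ∀ x ∈ F i, π x ∈ F i := by
  obtain ⟨C, hd, hC⟩ := exists_complement_adapted T N F hF hN
  have hc : IsCompl T C := ⟨hd.symm, by
    rw [codisjoint_iff, eq_top_iff, ← h0]
    exact (hC 0).trans (sup_comm T C ▸ sup_le_sup inf_le_left inf_le_left)⟩
  have hπ : ∀ t ∈ T, T.projection C hc t = t := fun t ht =>
    congrArg Subtype.val (Submodule.projectionOnto_apply_left hc ⟨t, ht⟩)
  refine ⟨T.projection C hc, Submodule.range_projection hc, hπ, fun i x hx => ?_⟩
  obtain ⟨c, hcC, t, ht, rfl⟩ := Submodule.mem_sup.1 (hC i hx)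
  rw [map_add, hπ t ht.1, (Submodule.projection_apply_eq_zero_iff hc).2 hcC.1, zero_add]
  exact ht.2

variable {F : ℕ → Submodule K V}

theorem pow_apply_mem {Y : Module.End K V} (hY : ∀ i, ∀ v ∈ F i, Y v ∈ F (i + 1)) {i : ℕ} {v : V}
    (hv : v ∈ F i) (k : ℕ) : (Y ^ k) v ∈ F (i + k) := by
  induction k with
  | zero => simpa using hv
  | succ k ih => rw [pow_succ', Module.End.mul_apply]; exact hY _ _ ih

/-- The exponential series, truncated to its first `n` terms. -/
def truncExp {R : Type*} [Ring R] [Algebra K R] (n : ℕ) (x : R) : R :=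
  ∑ k ∈ Finset.range n, (k.factorial : K)⁻¹ • x ^ k

/-- All terms of degree at least two apply `Y` again to `Y v`, which moves them one step down the
flag. Taking `M + 2` terms guarantees that the constant and linear terms are present. -/
theorem truncExp_sub_mem (hF : Antitone F) {Y : Module.End K V}
    (hY : ∀ i, ∀ v ∈ F i, Y v ∈ F (i + 1)) (M : ℕ) {i : ℕ} {v : V} (hv : Y v ∈ F i) :
    truncExp (K := K) (M + 2) Y v - (v + Y v) ∈ F (i + 1) := by
  rw [truncExp, Finset.sum_range_succ', Finset.sum_range_succ']
  have : ∀ k, (Y ^ (k + 1 + 1)) v ∈ F (i + 1) := fun k => by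
    rw [pow_succ, Module.End.mul_apply]
    exact hF (by omega) (pow_apply_mem hY hv (k + 1))
  convert Submodule.sum_mem _ fun k (_ : k ∈ Finset.range M) =>
    Submodule.smul_mem _ ((k + 1 + 1).factorial : K)⁻¹ (this k) using 1
  simp [LinearMap.sum_apply]
  abel

theorem truncExp_sub_self_mem (hF : Antitone F) {Y : Module.End K V}
    (hY : ∀ i, ∀ v ∈ F i, Y v ∈ F (i + 1)) (M : ℕ) {i : ℕ} {v : V} (hv : v ∈ F i) :
    truncExp (K := K) (M + 2) Y v - v ∈ F (i + 1) := by
  have h := add_mem (hF (by omega) (truncExp_sub_mem hF hY M (hY i v hv))) (hY i v hv)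
  convert h using 1
  abel

/-- If the truncated exponential of `Y` fixes `v` modulo a term of the flag, then `Y` kills `v`
modulo that term. -/
theorem apply_mem_of_truncExp_sub_mem (hF : Antitone F) (h0 : F 0 = ⊤) {Y : Module.End K V}
    (hY : ∀ i, ∀ v ∈ F i, Y v ∈ F (i + 1)) (M : ℕ) {i : ℕ} {v : V}
    (hv : truncExp (K := K) (M + 2) Y v - v ∈ F i) : Y v ∈ F i := by
  suffices ∀ j ≤ i, Y v ∈ F j from this i le_rfl
  intro j
  induction j with
  | zero => intro _; rw [h0]; trivial
  | succ j ih =>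
    intro hj
    have h := sub_mem (hF hj hv) (truncExp_sub_mem hF hY M (ih (by omega)))
    convert h using 1
    abel

end Flag

/-! ### Graphs of analytic maps as submanifolds -/

section Chart

variable {K V : Type*} [NontriviallyNormedField K] [NormedAddCommGroup V] [NormedSpace K V]

/-- The image of an analytic map that factors through a projection `π` and is a section of it is
an analytic submanifold: it is the graph of an analytic map. -/
theorem isAnalyticSubmanifoldOfNormed_range (π : V →L[K] V) (f : V → V)
    (hf : AnalyticOnNhd K f Set.univ) (hππ : ∀ x, π (π x) = π x) (hfπ : ∀ x, f (π x) = f x)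
    (hπf : ∀ x, π (f x) = π x) :
    IsAnalyticSubmanifoldOfNormed K (Set.range f)
      (Module.finrank K (LinearMap.range π.toLinearMap)) := by
  have h1 : AnalyticOnNhd K (fun x => x - f x + π x) Set.univ := fun x hx =>
    (analyticAt_id.sub (hf x hx)).add (π.analyticAt x)
  have h2 : AnalyticOnNhd K (fun x => x + f x - π x) Set.univ := fun x hx =>
    (analyticAt_id.add (hf x hx)).sub (π.analyticAt x)
  have p1 : ∀ x, π (x - f x + π x) = π x := fun x => by simp [hππ, hπf]
  have p2 : ∀ x, π (x + f x - π x) = π x := fun x => by simp [hππ, hπf]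
  have f1 : ∀ x, f (x - f x + π x) = f x := fun x => by rw [← hfπ, p1, hfπ]
  have f2 : ∀ x, f (x + f x - π x) = f x := fun x => by rw [← hfπ, p2, hfπ]
  -- A shear: the translation vector `π x - f x` lies in the kernel of `π` and depends only on `π
  -- x`, so the opposite translation inverts the map. It flattens the graph onto the range of `π`,
  -- giving one global chart.
  let Φ : V ≃ₜ V :=
    { toFun := fun x => x - f x + π x
      invFun := fun x => x + f x - π x
      left_inv := fun x => by simp only [p1, f1]; abel
      right_inv := fun x => by simp only [p2, f2]; abel
      continuous_toFun := continuousOn_univ.1 h1.continuousOn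
      continuous_invFun := continuousOn_univ.1 h2.continuousOn }
  have hΦ : ∀ x, Φ (f x) = π x := fun x => by
    have : f (f x) = f x := by rw [← hfπ, hπf, hfπ]
    change f x - f (f x) + π (f x) = π x
    rw [this, hπf]; abel
  intro x _
  refine ⟨Φ.toOpenPartialHomeomorph, trivial, h1, h2, _, rfl, ?_⟩
  ext y
  constructor
  · rintro ⟨_, ⟨_, ⟨z, rfl⟩⟩, rfl⟩
    exact ⟨trivial, z, (hΦ z).symm⟩
  · rintro ⟨_, z, rfl⟩
    exact ⟨f z, ⟨trivial, z, rfl⟩, hΦ z⟩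

end Chart

/-! ### Orbits of unipotent groups of exponentials -/

section Orbit

variable {K V : Type*} [NontriviallyNormedField K] [CompleteSpace K]
  [NormedAddCommGroup V] [NormedSpace K V] [FiniteDimensional K V]

/-- The orbits of a group of exponentials that acts unipotently with respect to a flag are
analytic submanifolds. -/
theorem isAnalyticSubmanifoldOfNormed_orbit {G : Type*} [Group G] (ρ : Representation K G V)
    {L : Type*} [AddCommGroup L] [Module K L] (δ : L →ₗ[K] Module.End K V)
    {F : ℕ → Submodule K V} (hF : Antitone F) (h0 : F 0 = ⊤) {N : ℕ} (hN : F N = ⊥)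
    (hδ : ∀ X, ∀ i, ∀ v ∈ F i, δ X v ∈ F (i + 1)) {E : L → G} (hE : Function.Surjective E) (M : ℕ)
    (hρ : ∀ X, ρ (E X) = truncExp (K := K) (M + 2) (δ X)) (v : V) :
    IsAnalyticSubmanifoldOfNormed K (Set.range fun g => ρ g v)
      (Module.finrank K (LinearMap.range (δ.flip v))) := by
  obtain ⟨π, hπT, hπ, hπF⟩ := exists_projection_adapted (LinearMap.range (δ.flip v)) hF h0 hN
  have hπm : ∀ x, π x ∈ LinearMap.range (δ.flip v) := fun x => hπT ▸ ⟨x, rfl⟩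
  obtain ⟨s, hs⟩ := (δ.flip v).rangeRestrict.exists_rightInverse_of_surjective
    (LinearMap.range_rangeRestrict _)
  -- the lift of a tangent vector to `L`
  let r : V →ₗ[K] L := s ∘ₗ π.codRestrict _ hπm
  have hr : ∀ x, δ (r x) v = π x := fun x =>
    congrArg Subtype.val (LinearMap.congr_fun hs (π.codRestrict _ hπm x))
  let c : Module.End K V ≃ₐ[K] (V →L[K] V) := Module.End.toContinuousLinearMap V
  let S : V →L[K] (V →L[K] V) := LinearMap.toContinuousLinearMap (c.toLinearMap ∘ₗ δ ∘ₗ r)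
  -- Successive approximation inside the group: the error `x - g v` is projected to the tangent
  -- space, lifted to `L` and exponentiated. The new factor stands on the right, so it acts on `v`
  -- itself, where the lift `r` was chosen; `g` then acts trivially on the graded pieces of the flag
  -- and leaves the leading term unchanged.
  let m : ℕ → V → (V →L[K] V) := fun i x =>
    Nat.rec 1 (fun _ g => g * truncExp (K := K) (M + 2) (S (x - g v))) i
  have m0 : ∀ x, m 0 x = 1 := fun _ => rfl
  have ms : ∀ i x, m (i + 1) x = m i x * truncExp (K := K) (M + 2) (S (x - m i x v)) :=
    fun _ _ => rfl
  have hexp : ∀ x w, truncExp (K := K) (M + 2) (S x) w = ρ (E (r x)) w := fun x w => by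
    rw [hρ, truncExp, truncExp]
    have : S x = c (δ (r x)) := rfl
    rw [this]
    simp only [← map_pow, ← map_smul, ← map_sum]
    rfl
  have man : ∀ i, AnalyticOnNhd K (m i) Set.univ := by
    intro i
    induction i with
    | zero => exact fun x _ => analyticAt_const
    | succ i ih =>
      intro x hx
      have hev := (ContinuousLinearMap.apply K V v).analyticAt (m i x)
      have h1 : AnalyticAt K (fun x => S (x - m i x v)) x :=
        (S.analyticAt _).fun_comp (analyticAt_id.sub (hev.fun_comp (ih x hx)))
      refine (ih x hx).mul ?_
      exact Finset.analyticAt_fun_sum _ fun k _ => AnalyticAt.fun_smul analyticAt_const (h1.fun_pow k)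
  have mG : ∀ i x, ∃ g, ∀ w, m i x w = ρ g w := by
    intro i x
    induction i with
    | zero => exact ⟨1, fun w => by simp [m0]⟩
    | succ i ih =>
      obtain ⟨g, hg⟩ := ih
      refine ⟨g * E (r (x - m i x v)), fun w => ?_⟩
      rw [ms, map_mul, mul_apply_eq_comp, hexp, hg, Module.End.mul_apply]
  have hρF : ∀ g i, ∀ w ∈ F i, ρ g w - w ∈ F (i + 1) := by
    intro g i w hw
    obtain ⟨X, rfl⟩ := hE g
    rw [hρ]
    exact truncExp_sub_self_mem hF (hδ X) M hw
  -- the recursion step, modulo `F (i + 1)`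
  have step : ∀ i x, π (x - m i x v) ∈ F i →
      m (i + 1) x v - (m i x v + π (x - m i x v)) ∈ F (i + 1) := by
    intro i x hx
    obtain ⟨g, hg⟩ := mG i x
    rw [ms, mul_apply_eq_comp, hexp]
    simp only [hg, hρ] at hx ⊢
    set u := π (x - ρ g v) with hu
    have h1 : truncExp (K := K) (M + 2) (δ (r (x - ρ g v))) v - (v + u) ∈ F (i + 1) := by
      have := truncExp_sub_mem (v := v) hF (hδ (r (x - ρ g v))) M (i := i) (by rwa [hr])
      rwa [hr] at this
    have h2 : ∀ w ∈ F (i + 1), ρ g w ∈ F (i + 1) := fun w hw => by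
      simpa using add_mem (hF (by omega) (hρF g _ w hw)) hw
    have h3 := add_mem (h2 _ h1) (hρF g i u hx)
    rw [map_sub, map_add] at h3
    convert h3 using 1
    abel
  have hsec : ∀ i x, π x - π (m i x v) ∈ F i := by
    intro i x
    induction i with
    | zero => rw [h0]; trivial
    | succ i ih =>
      have h := hπF _ _ (step i x (by rwa [map_sub]))
      rw [map_sub, map_add, hπ _ (hπm _), map_sub] at h
      convert neg_mem h using 1
      abel
  have hfix : ∀ i g, ρ g v - m i (ρ g v) v ∈ F i := by
    intro i g
    induction i with
    | zero => rw [h0]; trivial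
    | succ i ih =>
      obtain ⟨g', hg'⟩ := mG i (ρ g v)
      -- The element relating the approximation to the orbit point is again an exponential, and it
      -- fixes `v` modulo `F i`. Hence `δ Y v` lies in `F i`, and modulo `F (i + 1)` the error
      -- equals this tangent vector. Since `π` fixes it, the next correction removes it.
      obtain ⟨Y, hY⟩ := hE (g'⁻¹ * g)
      have hinv : ∀ w, ρ g'⁻¹ (ρ g' w) = w := fun w => by
        rw [← Module.End.mul_apply, ← map_mul]; simp
      have hmem : ∀ g j, ∀ w ∈ F j, ρ g w ∈ F j := fun g j w hw => by
        simpa using add_mem (hF (by omega) (hρF g _ w hw)) hw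
      have h1 : ρ (E Y) v - v ∈ F i := by
        have := hmem g'⁻¹ _ _ ih
        rw [hg', map_sub, hinv] at this
        rwa [hY, map_mul, Module.End.mul_apply]
      rw [hρ] at h1
      have h2 := apply_mem_of_truncExp_sub_mem hF h0 (hδ Y) M h1
      have h3 := truncExp_sub_mem hF (hδ Y) M h2
      rw [← hρ, hY, map_mul, Module.End.mul_apply] at h3
      have h4 := add_mem (hmem g' _ _ h3) (hρF g' i _ h2)
      have hinv' : ∀ w, ρ g' (ρ g'⁻¹ w) = w := fun w => by
        rw [← Module.End.mul_apply, ← map_mul]; simp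
      rw [map_sub, map_add, hinv'] at h4
      -- `y - m y v = t` modulo `F (i + 1)`
      set t := δ Y v with ht
      have h5 : ρ g v - m i (ρ g v) v - t ∈ F (i + 1) := by
        rw [hg']
        convert h4 using 1
        abel
      have h6 := hπF _ _ h5
      rw [map_sub, hπ t ⟨Y, rfl⟩] at h6
      have h7 := step i (ρ g v) (hπF _ _ ih)
      have h8 := sub_mem (sub_mem h5 h6) h7
      convert h8 using 1
      abel
  have hNz : ∀ {x}, x ∈ F N → x = 0 := fun {x} hx => by rwa [hN] at hx
  have hπf : ∀ x, π (m N x v) = π x := fun x => (sub_eq_zero.1 (hNz (hsec N x))).symm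
  have hrange : (Set.range fun g => ρ g v) = Set.range fun x => m N x v := by
    ext y
    constructor
    · rintro ⟨g, rfl⟩
      exact ⟨ρ g v, (sub_eq_zero.1 (hNz (hfix N g))).symm⟩
    · rintro ⟨x, rfl⟩
      obtain ⟨g, hg⟩ := mG N x
      exact ⟨g, (hg v).symm⟩
  have hππ : ∀ x, π (π x) = π x := fun x => hπ _ (hπm x)
  -- The iteration sees `x` only through `π x`, because the lift `r` factors through `π`.
  have hSπ : ∀ x w, S (π x - w) = S (x - w) := fun x w => by
    have : ∀ x, r (π x) = r x := fun x => by
      simp only [r, LinearMap.comp_apply]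
      congr 1
      exact Subtype.ext (hππ x)
    rw [map_sub, map_sub]
    congr 1
    exact congrArg (fun z => c (δ z)) (this x)
  have hmπ : ∀ i x, m i (π x) = m i x := by
    intro i x
    induction i with
    | zero => rfl
    | succ i ih => rw [ms, ms, ih, hSπ]
  rw [hrange, ← hπT]
  exact isAnalyticSubmanifoldOfNormed_range (LinearMap.toContinuousLinearMap π) _
    (fun x hx => ((ContinuousLinearMap.apply K V v).analyticAt _).fun_comp (man N x hx)) hππ
    (fun x => congrArg (fun g : V →L[K] V => g v) (hmπ N x)) hπf

end Orbit

/-! ### Conilpotency of the coordinate ring of a unipotent group -/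

section Conilpotent

open Coalgebra

variable (A : Type*) [CommRing A] [HopfAlgebra ℚ A]

/-- The map `a ↦ Δ a - a ⊗ 1`, whose kernel consists of the vectors fixed by the regular
representation. -/
def reducedComul : A →ₗ[ℚ] A ⊗[ℚ] A := comul - (TensorProduct.mk ℚ A A).flip 1

/-- The ascending filtration of the regular representation by iterated fixed vectors. -/
def socle : ℕ → Submodule ℚ A
  | 0 => ⊥
  | n + 1 => LinearMap.ker ((socle n).mkQ.rTensor A ∘ₗ reducedComul A)

variable {A}

/-- Vanishing in `(A ⧸ p) ⊗ A` expresses membership in the image of `p ⊗ A`, a condition that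
weakens as `p` grows. -/
theorem mkQ_rTensor_of_le {p q : Submodule ℚ A} (h : p ≤ q) {t : A ⊗[ℚ] A}
    (ht : p.mkQ.rTensor A t = 0) : q.mkQ.rTensor A t = 0 := by
  have : q.mkQ = Submodule.mapQ p q LinearMap.id h ∘ₗ p.mkQ := by ext; rfl
  rw [this, LinearMap.rTensor_comp, LinearMap.comp_apply, ht, map_zero]

theorem mem_socle_succ {n : ℕ} {a : A} :
    a ∈ socle A (n + 1) ↔ (socle A n).mkQ.rTensor A (comul a - a ⊗ₜ[ℚ] 1) = 0 := Iff.rfl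

theorem socle_mono : Monotone (socle A) := by
  refine monotone_nat_of_le_succ fun n => ?_
  induction n with
  | zero => exact bot_le
  | succ n ih => exact fun a ha => mkQ_rTensor_of_le ih ha

theorem mkQ_rTensor_comul {n : ℕ} {a : A} (ha : a ∈ socle A n) :
    (socle A n).mkQ.rTensor A (comul (R := ℚ) a) = 0 := by
  cases n with
  | zero =>
    have : a = 0 := ha
    simp [this]
  | succ n =>
    have h := mkQ_rTensor_of_le (socle_mono n.le_succ) (mem_socle_succ.1 ha)
    have h0 : (socle A (n + 1)).mkQ a = 0 := by simpa using ha
    rw [map_sub, LinearMap.rTensor_tmul, h0, TensorProduct.zero_tmul, sub_zero] at h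
    exact h

/-- The regular representation on a quotient of `A` by a subrepresentation. -/
theorem isCoaction_quotient (W : Submodule ℚ A)
    (hW : W ≤ LinearMap.ker (W.mkQ.rTensor A ∘ₗ comul (R := ℚ))) :
    IsCoaction A (W.liftQ _ hW) := by
  have hq : W.liftQ _ hW ∘ₗ W.mkQ = W.mkQ.rTensor A ∘ₗ comul (R := ℚ) := Submodule.liftQ_mkQ _ _ _
  have hq' : ∀ x, W.liftQ _ hW (W.mkQ x) = W.mkQ.rTensor A (comul (R := ℚ) x) := fun x =>
    LinearMap.congr_fun hq x
  constructor
  · refine Submodule.linearMap_qext _ (LinearMap.ext fun x => ?_)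
    have h1 : (TensorProduct.assoc ℚ (A ⧸ W) A A).toLinearMap ∘ₗ
        (W.mkQ.rTensor A).rTensor A =
          W.mkQ.rTensor (A ⊗[ℚ] A) ∘ₗ (TensorProduct.assoc ℚ A A A).toLinearMap :=
      TensorProduct.ext_threefold fun _ _ _ => rfl
    have h2 : (comul (R := ℚ) (A := A)).lTensor (A ⧸ W) ∘ₗ W.mkQ.rTensor A =
        W.mkQ.rTensor (A ⊗[ℚ] A) ∘ₗ (comul (R := ℚ) (A := A)).lTensor A := by
      rw [LinearMap.lTensor_comp_rTensor, LinearMap.rTensor_comp_lTensor]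
    have h3 := LinearMap.congr_fun h1 ((comul (R := ℚ)).rTensor A (comul x))
    have h4 := LinearMap.congr_fun h2 (comul x)
    simp only [LinearMap.comp_apply] at h3 h4 ⊢
    rw [hq', h4, ← coassoc_apply, ← LinearMap.rTensor_comp_apply, hq, LinearMap.rTensor_comp_apply]
    exact h3
  · refine Submodule.linearMap_qext _ (LinearMap.ext fun x => ?_)
    have h1 : (counit (R := ℚ) (A := A)).lTensor (A ⧸ W) ∘ₗ W.mkQ.rTensor A =
        W.mkQ.rTensor ℚ ∘ₗ (counit (R := ℚ) (A := A)).lTensor A := by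
      rw [LinearMap.lTensor_comp_rTensor, LinearMap.rTensor_comp_lTensor]
    have h2 := LinearMap.congr_fun h1 (comul x)
    simp only [LinearMap.comp_apply] at h2 ⊢
    rw [hq', h2, lTensor_counit_comul]
    simp

/-- The coordinate ring of a unipotent group is the union of its socle filtration. -/
theorem exists_mem_socle (hA : IsUnipotent A) (a : A) : ∃ n, a ∈ socle A n := by
  have hdir : Directed (· ≤ ·) (socle A) := socle_mono.directed_le
  set W : Submodule ℚ A := ⨆ n, socle A n with hWdef
  have hmem : ∀ x, x ∈ W ↔ ∃ n, x ∈ socle A n := fun x => Submodule.mem_iSup_of_directed _ hdir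
  have hW : W ≤ LinearMap.ker (W.mkQ.rTensor A ∘ₗ comul (R := ℚ)) := fun x hx => by
    obtain ⟨n, hn⟩ := (hmem x).1 hx
    exact mkQ_rTensor_of_le (le_iSup (socle A) n) (mkQ_rTensor_comul hn)
  suffices W = ⊤ from (hmem a).1 (this ▸ Submodule.mem_top)
  by_contra hne
  have hnt : Nontrivial (A ⧸ W) := Submodule.Quotient.nontrivial_iff.2 hne
  obtain ⟨v, hv0, hv⟩ := hA (A ⧸ W) _ (isCoaction_quotient W hW) hnt
  obtain ⟨x, rfl⟩ := W.mkQ_surjective v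
  have hx : comul x - x ⊗ₜ[ℚ] 1 ∈ LinearMap.ker (W.mkQ.rTensor A) := by
    rw [LinearMap.mem_ker, map_sub, sub_eq_zero]
    exact hv
  rw [rTensor_mkQ] at hx
  obtain ⟨t, ht⟩ := hx
  -- A tensor over the union `W` involves only finitely many elements of `W`, so one step of the
  -- filtration contains them all. The fixed vector of the quotient thus already lies in the next
  -- step, hence in `W`.
  have key : ∀ t : W ⊗[ℚ] A, ∃ n, (socle A n).mkQ.rTensor A (W.subtype.rTensor A t) = 0 := by
    intro t
    induction t with
    | zero => exact ⟨0, by simp⟩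
    | tmul w b =>
      obtain ⟨n, hn⟩ := (hmem w).1 w.2
      refine ⟨n, ?_⟩
      have : (socle A n).mkQ (w : A) = 0 := by simpa using hn
      rw [LinearMap.rTensor_tmul, LinearMap.rTensor_tmul, Submodule.subtype_apply, this,
        TensorProduct.zero_tmul]
    | add s t hs ht =>
      obtain ⟨n, hn⟩ := hs
      obtain ⟨m, hm⟩ := ht
      refine ⟨max n m, ?_⟩
      rw [map_add, map_add, mkQ_rTensor_of_le (socle_mono (le_max_left n m)) hn,
        mkQ_rTensor_of_le (socle_mono (le_max_right n m)) hm, add_zero]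
  obtain ⟨n, hn⟩ := key t
  rw [ht] at hn
  refine hv0 ?_
  rw [Submodule.mkQ_apply, Submodule.Quotient.mk_eq_zero, hmem]
  exact ⟨n + 1, mem_socle_succ.2 hn⟩

variable (A) in
/-- The functionals on `A` with values in `K` that vanish at `1`. -/
def augFunctionals (K : Type*) [Field K] [Algebra ℚ K] : Submodule ℚ (WithConv (A →ₗ[ℚ] K)) where
  carrier := {f | f 1 = 0}
  add_mem' := fun {f g} hf hg => by
    change f 1 + g 1 = 0
    rw [hf, hg, add_zero]
  zero_mem' := rfl
  smul_mem' := fun c f hf => by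
    change c • f 1 = 0
    rw [show f 1 = 0 from hf]
    rw [Algebra.smul_def, mul_zero]

variable {K : Type*} [Field K] [Algebra ℚ K]

theorem mem_augFunctionals {f : WithConv (A →ₗ[ℚ] K)} : f ∈ augFunctionals A K ↔ f 1 = 0 := Iff.rfl

/-- Write `Δ a = (Δ a - a ⊗ 1) + a ⊗ 1`: the first part lies in the image of `socle A n ⊗ A`, where
`f` kills the left factor, and the second contributes `f a * g 1 = 0`. -/
theorem convMul_apply_socle {n : ℕ} {f g : WithConv (A →ₗ[ℚ] K)} (hf : ∀ a ∈ socle A n, f a = 0)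
    (hg : g 1 = 0) {a : A} (ha : a ∈ socle A (n + 1)) : (f * g) a = 0 := by
  let f' : A ⧸ socle A n →ₗ[ℚ] K := (socle A n).liftQ f.ofConv hf
  have h1 : LinearMap.mul' ℚ K ∘ₗ TensorProduct.map f.ofConv g.ofConv =
      (LinearMap.mul' ℚ K ∘ₗ TensorProduct.map f' g.ofConv) ∘ₗ (socle A n).mkQ.rTensor A :=
    TensorProduct.ext' fun _ _ => rfl
  have h2 := LinearMap.congr_fun h1 (comul a - a ⊗ₜ[ℚ] 1)
  rw [LinearMap.comp_apply (g := (socle A n).mkQ.rTensor A), mem_socle_succ.1 ha, map_zero, map_sub,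
    sub_eq_zero] at h2
  refine h2.trans ?_
  change f a * g 1 = 0
  rw [hg, mul_zero]

theorem apply_eq_zero_of_mem_pow {n : ℕ} {f : WithConv (A →ₗ[ℚ] K)}
    (hf : f ∈ augFunctionals A K ^ n) {a : A} (ha : a ∈ socle A n) : f a = 0 := by
  induction n generalizing f a with
  | zero =>
    have : a = 0 := ha
    rw [this]
    exact map_zero f.ofConv
  | succ n ih =>
    rw [pow_succ] at hf
    induction hf using Submodule.mul_induction_on' with
    | mem_mul_mem g hg h hh => exact convMul_apply_socle (fun a ha => ih hg ha) hh ha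
    | add g _ h _ hg hh =>
      change g a + h a = 0
      rw [hg, hh, add_zero]

/-- Products of sufficiently many functionals that vanish at `1` vanish at a given point. -/
theorem exists_forall_mem_pow_apply_eq_zero (hA : IsUnipotent A) (a : A) :
    ∃ n, ∀ m ≥ n, ∀ f ∈ augFunctionals A K ^ m, f a = 0 := by
  obtain ⟨n, hn⟩ := exists_mem_socle hA a
  exact ⟨n, fun m hm f hf => apply_eq_zero_of_mem_pow hf (socle_mono hm hn)⟩

end Conilpotent

/-- Regroups the product of two terminating series by total degree; needed for the multiplicativity
of the exponential and for the adjoint formula. -/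
theorem sum_range_antidiagonal {M : Type*} [AddCommMonoid M] (t : ℕ → ℕ → M) (N : ℕ)
    (h : ∀ i j, N ≤ i + j → t i j = 0) :
    ∑ n ∈ Finset.range N, ∑ p ∈ Finset.HasAntidiagonal.antidiagonal n, t p.1 p.2 =
      ∑ i ∈ Finset.range N, ∑ j ∈ Finset.range N, t i j := by
  rw [← Finset.sum_product',
    ← Finset.sum_filter_of_ne (p := fun p : ℕ × ℕ => p.1 + p.2 ∈ Finset.range N),
    ← Finset.sum_fiberwise_of_maps_to (t := Finset.range N) (g := fun p : ℕ × ℕ => p.1 + p.2)]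
  · refine Finset.sum_congr rfl fun n hn => Finset.sum_congr ?_ fun _ _ => rfl
    ext p
    simp only [Finset.HasAntidiagonal.mem_antidiagonal, Finset.mem_filter, Finset.mem_product, Finset.mem_range]
      at hn ⊢
    omega
  · intro p hp
    exact (Finset.mem_filter.1 hp).2
  · intro p _ hp
    by_contra hlt
    exact hp (h _ _ (by simpa using hlt))

/-! ### Locally finite sums of functionals -/

section LocSum

variable {A : Type*} [CommRing A] [HopfAlgebra ℚ A] {K : Type*} [Field K] [Algebra ℚ K]

/-- A sequence of functionals is locally nilpotent if at each point almost all of its terms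
vanish. -/
def LocallyNilpotent (c : ℕ → WithConv (A →ₗ[ℚ] K)) : Prop :=
  ∀ a, ∃ n, ∀ k ≥ n, c k a = 0

theorem finsum_eq_sum_range {c : ℕ → WithConv (A →ₗ[ℚ] K)} {a : A} {n : ℕ}
    (hn : ∀ k ≥ n, c k a = 0) : ∑ᶠ k, c k a = ∑ k ∈ Finset.range n, c k a :=
  finsum_eq_sum_of_support_subset _ fun k hk => by
    by_contra hlt
    exact hk (hn k (by simpa using hlt))

/-- The sum of a locally nilpotent sequence of functionals. -/
def locSum (c : ℕ → WithConv (A →ₗ[ℚ] K)) (hc : LocallyNilpotent c) :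
    WithConv (A →ₗ[ℚ] K) :=
  WithConv.toConv
    { toFun := fun a => ∑ᶠ k, c k a
      map_add' := fun a b => by
        obtain ⟨n, hn⟩ := hc a
        obtain ⟨m, hm⟩ := hc b
        have ha : ∀ k ≥ max n m, c k a = 0 := fun k hk => hn k (le_trans (le_max_left _ _) hk)
        have hb : ∀ k ≥ max n m, c k b = 0 := fun k hk => hm k (le_trans (le_max_right _ _) hk)
        have hab : ∀ k, c k (a + b) = c k a + c k b := fun k => map_add (c k).ofConv a b
        rw [finsum_eq_sum_range ha, finsum_eq_sum_range hb, ← Finset.sum_add_distrib,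
          finsum_eq_sum_range fun k hk => by rw [hab, ha k hk, hb k hk, add_zero]]
        exact Finset.sum_congr rfl fun k _ => hab k
      map_smul' := fun q a => by
        obtain ⟨n, hn⟩ := hc a
        have hqa : ∀ k, c k (q • a) = q • c k a := fun k => map_smul (c k).ofConv q a
        rw [finsum_eq_sum_range hn, RingHom.id_apply, Algebra.smul_def (A := K), Finset.mul_sum,
          finsum_eq_sum_range fun k hk => by rw [hqa, hn k hk, Algebra.smul_def (A := K), mul_zero]]
        exact Finset.sum_congr rfl fun k _ => (hqa k).trans (Algebra.smul_def _ _) }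

theorem locSum_apply {c : ℕ → WithConv (A →ₗ[ℚ] K)} (hc : LocallyNilpotent c) {a : A} {n : ℕ}
    (hn : ∀ k ≥ n, c k a = 0) : locSum c hc a = ∑ k ∈ Finset.range n, c k a :=
  finsum_eq_sum_range hn

end LocSum

/-! ### The exponential map -/

section Exp

open Coalgebra

variable {A : Type*} [CommRing A] [HopfAlgebra ℚ A] {K : Type*} [Field K] [Algebra ℚ K]

/-- The Leibniz rule says that `X` is primitive for the coproduct dual to multiplication, so right
convolution by `X` is a derivation for it. Stating this with an explicit finite decomposition of `F
(a * b)` avoids a coproduct on the full dual. -/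
theorem LieAlg.convMul_apply_mul {ι : Type*} (s : Finset ι) {F : WithConv (A →ₗ[ℚ] K)}
    {f h : ι → WithConv (A →ₗ[ℚ] K)} (hF : ∀ a b, F (a * b) = ∑ i ∈ s, f i a * h i b)
    (X : LieAlg A K) (a b : A) :
    (F * WithConv.toConv X.toLin) (a * b) =
      ∑ i ∈ s, ((f i * WithConv.toConv X.toLin) a * h i b +
        f i a * (h i * WithConv.toConv X.toLin) b) := by
  let r := Coalgebra.Repr.arbitrary ℚ a
  let q := Coalgebra.Repr.arbitrary ℚ b
  have hf : ∀ i, f i a = ∑ k ∈ r.index, f i (r.left k) *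
      algebraMap ℚ K (counit (r.right k)) := fun i => by
    conv_lhs => rw [← mul_one (f i)]
    exact r.convMul_apply _ _
  have hh : ∀ i, h i b = ∑ k ∈ q.index, h i (q.left k) *
      algebraMap ℚ K (counit (q.right k)) := fun i => by
    conv_lhs => rw [← mul_one (h i)]
    exact q.convMul_apply _ _
  have h1 : ∀ i, (f i * WithConv.toConv X.toLin) a * h i b +
      f i a * (h i * WithConv.toConv X.toLin) b = ∑ k ∈ r.index, ∑ l ∈ q.index,
        f i (r.left k) * h i (q.left l) * X.toLin (r.right k * q.right l) := fun i => by
    rw [r.convMul_apply, q.convMul_apply, hf, hh, Finset.sum_mul_sum, Finset.sum_mul_sum,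
      ← Finset.sum_add_distrib]
    refine Finset.sum_congr rfl fun k _ => ?_
    rw [← Finset.sum_add_distrib]
    refine Finset.sum_congr rfl fun l _ => ?_
    rw [X.leibniz]
    change f i (r.left k) * X.toLin (r.right k) * (h i (q.left l) * _) +
      f i (r.left k) * _ * (h i (q.left l) * X.toLin (q.right l)) = _
    ring
  simp only [h1]
  rw [(r.mul q).convMul_apply, Finset.sum_comm]
  refine (Finset.sum_product _ _ _).trans (Finset.sum_congr rfl fun k _ => ?_)
  rw [Finset.sum_comm]
  refine Finset.sum_congr rfl fun l _ => ?_
  change F (r.left k * q.left l) * X.toLin (r.right k * q.right l) = _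
  rw [hF, Finset.sum_mul]

/-- The divided powers of an element of the Lie algebra in the convolution algebra. -/
def LieAlg.divPow (X : LieAlg A K) (k : ℕ) : WithConv (A →ₗ[ℚ] K) :=
  (k.factorial : K)⁻¹ • (WithConv.toConv X.toLin) ^ k

variable (X : LieAlg A K)

theorem LieAlg.divPow_zero : X.divPow 0 = 1 := by
  simp [LieAlg.divPow]

theorem succ_cast_ne_zero (k : ℕ) : ((k : K) + 1) ≠ 0 := by
  have : CharZero K := algebraRat.charZero K
  exact_mod_cast k.succ_ne_zero

theorem LieAlg.divPow_succ (k : ℕ) :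
    ((k : K) + 1) • X.divPow (k + 1) = X.divPow k * WithConv.toConv X.toLin := by
  rw [LieAlg.divPow, LieAlg.divPow, smul_mul_assoc, ← pow_succ, smul_smul, Nat.factorial_succ]
  congr 1
  push_cast
  rw [mul_inv, ← mul_assoc, mul_inv_cancel₀ (succ_cast_ne_zero k), one_mul]

/-- The divided powers of a primitive element form a divided power sequence. After multiplication by
`k + 1` the induction reduces to the derivation rule, the factor splitting as `p.1 + p.2`. -/
theorem LieAlg.divPow_mul (k : ℕ) (a b : A) :
    X.divPow k (a * b) = ∑ p ∈ Finset.HasAntidiagonal.antidiagonal k, X.divPow p.1 a * X.divPow p.2 b := by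
  induction k generalizing a b with
  | zero =>
    simp only [LieAlg.divPow_zero, Finset.HasAntidiagonal.antidiagonal_zero,
      Finset.sum_singleton]
    exact Points.map_mul 1 a b
  | succ k ih =>
    refine mul_left_cancel₀ (succ_cast_ne_zero (K := K) k) ?_
    have e : ∀ (k : ℕ) a, ((k : K) + 1) * X.divPow (k + 1) a =
        (X.divPow k * WithConv.toConv X.toLin) a := fun k a =>
      congrArg (fun f : WithConv (A →ₗ[ℚ] K) => f a) (X.divPow_succ k)
    rw [e, X.convMul_apply_mul _ ih]
    simp only [← e]
    have h1 : ∑ p ∈ Finset.HasAntidiagonal.antidiagonal (k + 1), (p.1 : K) * (X.divPow p.1 a * X.divPow p.2 b) =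
        ∑ p ∈ Finset.HasAntidiagonal.antidiagonal k, ((p.1 : K) + 1) * X.divPow (p.1 + 1) a * X.divPow p.2 b := by
      rw [Finset.Nat.sum_antidiagonal_succ]
      simp [mul_assoc]
    have h2 : ∑ p ∈ Finset.HasAntidiagonal.antidiagonal (k + 1), (p.2 : K) * (X.divPow p.1 a * X.divPow p.2 b) =
        ∑ p ∈ Finset.HasAntidiagonal.antidiagonal k,
          X.divPow p.1 a * (((p.2 : K) + 1) * X.divPow (p.2 + 1) b) := by
      rw [Finset.Nat.sum_antidiagonal_succ']
      simp [mul_left_comm]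
    rw [Finset.sum_add_distrib, ← h1, ← h2, ← Finset.sum_add_distrib, Finset.mul_sum]
    refine Finset.sum_congr rfl fun p hp => ?_
    rw [← add_mul]
    have : p.1 + p.2 = k + 1 := Finset.HasAntidiagonal.mem_antidiagonal.1 hp
    congr 1
    rw [← Nat.cast_add, this, Nat.cast_succ]

theorem LieAlg.mem_augFunctionals : WithConv.toConv X.toLin ∈ augFunctionals A K := X.map_one

/-- The exponent must be positive: the powers are taken over ℚ, and the zeroth power is only the
ℚ-span of the unit. For positive exponents the scalar is absorbed by the first factor. -/
theorem smul_mem_augFunctionals_pow (c : K) {n : ℕ} {f : WithConv (A →ₗ[ℚ] K)}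
    (hf : f ∈ augFunctionals A K ^ (n + 1)) : c • f ∈ augFunctionals A K ^ (n + 1) := by
  rw [pow_succ'] at hf ⊢
  induction hf using Submodule.mul_induction_on' with
  | mem_mul_mem g hg h hh =>
    rw [← smul_mul_assoc]
    refine Submodule.mul_mem_mul ?_ hh
    change c * g 1 = 0
    rw [show g 1 = 0 from hg, mul_zero]
  | add g _ h _ hg hh => rw [smul_add]; exact add_mem hg hh

theorem LieAlg.divPow_mem (k : ℕ) : X.divPow (k + 1) ∈ augFunctionals A K ^ (k + 1) :=
  smul_mem_augFunctionals_pow _ (Submodule.pow_mem_pow _ X.mem_augFunctionals _)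

theorem LieAlg.exists_divPow_eq_zero (hA : IsUnipotent A) (a : A) :
    ∃ n, ∀ X : LieAlg A K, ∀ k ≥ n, X.divPow k a = 0 := by
  obtain ⟨n, hn⟩ := exists_forall_mem_pow_apply_eq_zero (K := K) hA a
  refine ⟨n + 1, fun X k hk => ?_⟩
  obtain ⟨k, rfl⟩ : ∃ j, k = j + 1 := ⟨k - 1, by omega⟩
  exact hn _ (by omega) _ (X.divPow_mem k)

theorem LieAlg.locallyNilpotent_divPow (hA : IsUnipotent A) : LocallyNilpotent X.divPow :=
  fun a => (LieAlg.exists_divPow_eq_zero hA a).imp fun _ h => h X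

/-- The exponential of an element of the Lie algebra of a unipotent group. -/
def LieAlg.exp (hA : IsUnipotent A) (X : LieAlg A K) : Points A K :=
  WithConv.toConv <| AlgHom.ofLinearMap (locSum X.divPow (X.locallyNilpotent_divPow hA)).ofConv
    (by
      have h : ∀ k ≥ 1, X.divPow k (1 : A) = 0 := fun k hk => by
        obtain ⟨k, rfl⟩ : ∃ j, k = j + 1 := ⟨k - 1, by omega⟩
        refine mul_left_cancel₀ (succ_cast_ne_zero (K := K) k) ?_
        have e : ((k : K) + 1) * X.divPow (k + 1) 1 =
            (X.divPow k * WithConv.toConv X.toLin) 1 :=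
          congrArg (fun f : WithConv (A →ₗ[ℚ] K) => f 1) (X.divPow_succ k)
        rw [e, mul_zero, LinearMap.convMul_apply, Bialgebra.comul_one,
          Algebra.TensorProduct.one_def, TensorProduct.map_tmul, LinearMap.mul'_apply,
          WithConv.ofConv_toConv, X.map_one, mul_zero]
      refine (locSum_apply _ h).trans ?_
      rw [Finset.sum_range_one, LieAlg.divPow_zero]
      simp)
    (fun a b => by
      obtain ⟨n, hn⟩ := X.locallyNilpotent_divPow hA a
      obtain ⟨m, hm⟩ := X.locallyNilpotent_divPow hA b
      have ht : ∀ i j, n + m ≤ i + j → X.divPow i a * X.divPow j b = 0 := fun i j hij => by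
        rcases le_or_gt n i with h | h
        · rw [hn i h, zero_mul]
        · rw [hm j (by omega), mul_zero]
      have hab : ∀ k ≥ n + m, X.divPow k (a * b) = 0 := fun k hk => by
        rw [X.divPow_mul]
        refine Finset.sum_eq_zero fun p hp => ht _ _ ?_
        rw [Finset.HasAntidiagonal.mem_antidiagonal.1 hp]
        exact hk
      refine (locSum_apply _ hab).trans ?_
      simp only [X.divPow_mul]
      rw [sum_range_antidiagonal _ _ ht, ← Finset.sum_mul_sum]
      exact congrArg₂ _ (locSum_apply (n := n + m) _ fun k hk => hn k (by omega)).symm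
        (locSum_apply (n := n + m) _ fun k hk => hm k (by omega)).symm)

theorem LieAlg.exp_apply (hA : IsUnipotent A) {a : A} {n : ℕ} (hn : ∀ k ≥ n, X.divPow k a = 0) :
    (X.exp hA).toLin a = ∑ k ∈ Finset.range n, X.divPow k a :=
  locSum_apply (X.locallyNilpotent_divPow hA) hn

end Exp

/-! ### The logarithm and surjectivity of the exponential -/

section Log

open Coalgebra Polynomial

theorem polynomial_eq_of_eval_nat_eq {K : Type*} [Field K] [CharZero K] {p q : K[X]}
    (h : ∀ n : ℕ, p.eval (n : K) = q.eval (n : K)) : p = q :=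
  Polynomial.eq_of_infinite_eval_eq p q <|
    (Set.infinite_range_of_injective (Nat.cast_injective (R := K))).mono <| by
      rintro _ ⟨n, rfl⟩
      exact h n

variable {A : Type*} [CommRing A] [HopfAlgebra ℚ A] {K : Type*} [Field K] [CharZero K] [Algebra ℚ K]

omit [CharZero K] in
theorem Points.toLin_pow (g : Points A K) (n : ℕ) : (g ^ n).toLin = g.toLin ^ n := by
  induction n with
  | zero => rw [pow_zero, pow_zero, Points.toLin_one]
  | succ n ih => rw [pow_succ, pow_succ, Points.toLin_mul, ih]

/-- The matrix coefficients of the powers of a point of a unipotent group are polynomials in the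
exponent. -/
theorem Points.exists_polynomial (hA : IsUnipotent A) (g : Points A K) (a : A) :
    ∃ p : K[X], ∀ n : ℕ, p.eval (n : K) = (g.toLin ^ n) a := by
  have hf : g.toLin - 1 ∈ augFunctionals A K := by
    change g.toLin 1 - (1 : WithConv (A →ₗ[ℚ] K)) 1 = 0
    rw [LinearMap.convOne_apply, Bialgebra.counit_one, sub_eq_zero]
    exact (_root_.map_one (WithConv.ofConv g)).trans (_root_.map_one (algebraMap ℚ K)).symm
  obtain ⟨N, hN⟩ := exists_forall_mem_pow_apply_eq_zero (K := K) hA a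
  have h0 : ∀ k ≥ N, ((g.toLin - 1) ^ k) a = 0 := fun k hk =>
    hN k hk _ (Submodule.pow_mem_pow _ hf _)
  -- Binomial expansion of `(1 + (g - 1)) ^ n` at `a`: the terms with `k ≥ N` vanish for every `n`,
  -- and `n.choose k` is the descending Pochhammer polynomial at `n` divided by `k!`.
  refine ⟨∑ k ∈ Finset.range N,
    C (((g.toLin - 1) ^ k) a * (k.factorial : K)⁻¹) * descPochhammer K k, fun n => ?_⟩
  have h1 : (g.toLin ^ n) a = ∑ k ∈ Finset.range (n + 1), ((g.toLin - 1) ^ k) a * n.choose k := by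
    conv_lhs => rw [← sub_add_cancel g.toLin 1, (Commute.one_right (g.toLin - 1)).add_pow]
    have : ∀ (s : Finset ℕ) (f : ℕ → WithConv (A →ₗ[ℚ] K)),
        (∑ k ∈ s, f k) a = ∑ k ∈ s, f k a := fun s f => by
      rw [WithConv.ofConv_sum, LinearMap.sum_apply]
    rw [this]
    refine Finset.sum_congr rfl fun k _ => ?_
    rw [one_pow, mul_one, ← nsmul_eq_mul', ← nsmul_eq_mul']
    rfl
  have h2 : ∀ k, (C (((g.toLin - 1) ^ k) a * (k.factorial : K)⁻¹) * descPochhammer K k).eval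
      (n : K) = ((g.toLin - 1) ^ k) a * n.choose k := fun k => by
    rw [eval_mul, eval_C, descPochhammer_eval_eq_descFactorial,
      Nat.descFactorial_eq_factorial_mul_choose, Nat.cast_mul, mul_assoc,
      inv_mul_cancel_left₀ (Nat.cast_ne_zero.2 k.factorial_ne_zero)]
  rw [h1, eval_finsetSum, Finset.sum_congr rfl fun k _ => h2 k]
  rcases le_total N (n + 1) with h | h
  · refine Finset.sum_subset (Finset.range_mono h) fun k _ hk => ?_
    rw [h0 k (by simpa using hk), zero_mul]
  · refine (Finset.sum_subset (Finset.range_mono h) fun k _ hk => ?_).symm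
    rw [Nat.choose_eq_zero_of_lt (by simpa using hk), Nat.cast_zero, mul_zero]

/-- The polynomial whose values at natural numbers are the values of the powers of `g`. -/
def Points.powPoly (hA : IsUnipotent A) (g : Points A K) (a : A) : K[X] :=
  (g.exists_polynomial hA a).choose

variable (hA : IsUnipotent A) (g : Points A K)

theorem Points.powPoly_eval (a : A) (n : ℕ) : (g.powPoly hA a).eval (n : K) = (g.toLin ^ n) a :=
  (g.exists_polynomial hA a).choose_spec n

theorem Points.powPoly_add (a b : A) :
    g.powPoly hA (a + b) = g.powPoly hA a + g.powPoly hA b :=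
  polynomial_eq_of_eval_nat_eq fun n => by
    rw [eval_add]
    simp only [Points.powPoly_eval]
    exact map_add (g.toLin ^ n).ofConv a b

theorem Points.powPoly_smul (q : ℚ) (a : A) :
    g.powPoly hA (q • a) = C (algebraMap ℚ K q) * g.powPoly hA a :=
  polynomial_eq_of_eval_nat_eq fun n => by
    rw [eval_mul, eval_C]
    simp only [Points.powPoly_eval]
    exact (map_smul (g.toLin ^ n).ofConv q a).trans (Algebra.smul_def _ _)

theorem Points.powPoly_mul (a b : A) :
    g.powPoly hA (a * b) = g.powPoly hA a * g.powPoly hA b :=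
  polynomial_eq_of_eval_nat_eq fun n => by
    rw [eval_mul]
    simp only [Points.powPoly_eval, ← Points.toLin_pow]
    exact Points.map_mul _ a b

theorem Points.powPoly_coeff_zero (a : A) :
    (g.powPoly hA a).coeff 0 = algebraMap ℚ K (counit a) := by
  rw [coeff_zero_eq_eval_zero, ← Nat.cast_zero, Points.powPoly_eval, pow_zero]
  rfl

/-- The coefficients of the polynomials `powPoly` as functionals. -/
def Points.powCoeff (k : ℕ) : WithConv (A →ₗ[ℚ] K) :=
  WithConv.toConv
    { toFun := fun a => (g.powPoly hA a).coeff k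
      map_add' := fun a b => by rw [Points.powPoly_add, coeff_add]
      map_smul' := fun q a => by
        rw [Points.powPoly_smul, coeff_C_mul, RingHom.id_apply, Algebra.smul_def (A := K)] }

theorem Points.powCoeff_apply (k : ℕ) (a : A) :
    g.powCoeff hA k a = (g.powPoly hA a).coeff k := rfl

/-- The logarithm of a point of a unipotent group. -/
def Points.log : LieAlg A K :=
  ⟨(g.powCoeff hA 1).ofConv, fun a b => by
    simp only [Points.powCoeff_apply, Points.powPoly_mul, mul_coeff_one,
      Points.powPoly_coeff_zero]
    ring⟩

/-- Infinitesimal form of `g ^ (n + m) = g ^ n * g ^ m`: as polynomials in `m`, both sides have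
equal linear coefficients, the left one being the derivative at `n`. -/
theorem Points.derivative_powPoly {ι : Type*} {a : A} (r : Coalgebra.Repr ℚ a ι) :
    derivative (g.powPoly hA a) =
      ∑ i ∈ r.index, C ((g.log hA).toLin (r.right i)) * g.powPoly hA (r.left i) := by
  refine polynomial_eq_of_eval_nat_eq fun n => ?_
  have h : taylor (n : K) (g.powPoly hA a) =
      ∑ i ∈ r.index, C ((g.toLin ^ n) (r.left i)) * g.powPoly hA (r.right i) :=
    polynomial_eq_of_eval_nat_eq fun m => by
      rw [taylor_eval, ← Nat.cast_add, Points.powPoly_eval, add_comm, pow_add, r.convMul_apply,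
        eval_finsetSum]
      simp only [eval_mul, eval_C, Points.powPoly_eval]
  rw [← taylor_coeff_one, h, finsetSum_coeff, eval_finsetSum]
  refine Finset.sum_congr rfl fun i _ => ?_
  rw [coeff_C_mul, eval_mul, eval_C, Points.powPoly_eval, mul_comm]
  rfl

theorem Points.powCoeff_succ (k : ℕ) : ((k : K) + 1) • g.powCoeff hA (k + 1) =
    g.powCoeff hA k * WithConv.toConv (g.log hA).toLin := by
  refine WithConv.ext (LinearMap.ext fun a => ?_)
  let r := Coalgebra.Repr.arbitrary ℚ a
  have h := congrArg (fun p => p.coeff k) (g.derivative_powPoly hA r)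
  simp only [coeff_derivative, finsetSum_coeff, coeff_C_mul] at h
  refine Eq.trans ?_ (r.convMul_apply _ _).symm
  refine (mul_comm _ _).trans (h.trans (Finset.sum_congr rfl fun i _ => mul_comm _ _))

/-- Both sequences start at the counit and satisfy the same recursion, so the polynomial of `g` is
`exp (t log g)`; its value at `t = 1` gives `exp_log`. -/
theorem Points.powCoeff_eq_divPow (k : ℕ) : g.powCoeff hA k = (g.log hA).divPow k := by
  induction k with
  | zero =>
    rw [LieAlg.divPow_zero]
    exact WithConv.ext (LinearMap.ext fun a => g.powPoly_coeff_zero hA a)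
  | succ k ih =>
    have h := g.powCoeff_succ hA k
    rw [ih, ← LieAlg.divPow_succ] at h
    exact smul_right_injective _ (succ_cast_ne_zero k) h

theorem Points.exp_log : (g.log hA).exp hA = g := by
  refine Points.toLin_injective (WithConv.ext (LinearMap.ext fun a => ?_))
  obtain ⟨n, hn⟩ := (g.log hA).locallyNilpotent_divPow hA a
  have h1 := g.powPoly_eval hA a 1
  rw [pow_one, Nat.cast_one,
    eval_eq_sum_range' (n := max n ((g.powPoly hA a).natDegree + 1)) (by simp)] at h1
  refine (LieAlg.exp_apply (n := max n ((g.powPoly hA a).natDegree + 1)) _ hA fun k hk =>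
    hn k (le_trans (le_max_left _ _) hk)).trans ?_
  refine Eq.trans (Finset.sum_congr rfl fun k _ => ?_) h1
  rw [one_pow, mul_one, ← Points.powCoeff_eq_divPow]
  rfl

/-- The exponential map of a unipotent group is surjective. -/
theorem LieAlg.exp_surjective :
    Function.Surjective (LieAlg.exp hA : LieAlg A K → Points A K) :=
  fun g => ⟨g.log hA, g.exp_log hA⟩

end Log

/-! ### The adjoint representation and nilpotency of the Lie algebra -/

section Adjoint

open Coalgebra

variable {A : Type*} [CommRing A] [HopfAlgebra ℚ A] {K : Type*} [Field K] [Algebra ℚ K]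

theorem LieAlg.convMul_leibniz (X D : LieAlg A K) (a b : A) :
    (WithConv.toConv X.toLin * WithConv.toConv D.toLin) (a * b) =
      algebraMap ℚ K (counit a) * (WithConv.toConv X.toLin * WithConv.toConv D.toLin) b +
      algebraMap ℚ K (counit b) * (WithConv.toConv X.toLin * WithConv.toConv D.toLin) a +
      (X.toLin a * D.toLin b + D.toLin a * X.toLin b) := by
  have h := D.convMul_apply_mul (Finset.univ : Finset Bool) (F := WithConv.toConv X.toLin)
    (f := fun i => bif i then 1 else WithConv.toConv X.toLin)
    (h := fun i => bif i then WithConv.toConv X.toLin else 1)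
    (fun a b => by
      rw [Fintype.sum_bool]
      refine (X.leibniz a b).trans ?_
      rw [mul_comm (algebraMap ℚ K (counit b))]
      rfl) a b
  rw [Fintype.sum_bool] at h
  simp only [cond_true, cond_false, one_mul] at h
  rw [h]
  simp only [LinearMap.convOne_apply]
  ring

/-- The commutator of two elements of the Lie algebra in the convolution algebra. -/
def LieAlg.bracket (X D : LieAlg A K) : LieAlg A K :=
  ⟨(WithConv.toConv X.toLin * WithConv.toConv D.toLin -
    WithConv.toConv D.toLin * WithConv.toConv X.toLin).ofConv, fun a b => by
      simp only [WithConv.ofConv_sub, LinearMap.sub_apply]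
      rw [X.convMul_leibniz, D.convMul_leibniz]
      ring⟩

theorem LieAlg.bracket_toLin (X D : LieAlg A K) : WithConv.toConv (X.bracket D).toLin =
    WithConv.toConv X.toLin * WithConv.toConv D.toLin -
      WithConv.toConv D.toLin * WithConv.toConv X.toLin := rfl

theorem LieAlg.toLin_injective :
    Function.Injective fun D : LieAlg A K => WithConv.toConv D.toLin :=
  fun _ _ h => Subtype.ext (congrArg WithConv.ofConv h)

variable (A K)

/-- The adjoint representation of the Lie algebra. -/
def LieAlg.ad : LieAlg A K →ₗ[K] Module.End K (LieAlg A K) :=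
  LinearMap.mk₂ K LieAlg.bracket
    (fun X Y D => LieAlg.toLin_injective (by
      simp only [LieAlg.bracket_toLin, map_add, WithConv.toConv_add]
      noncomm_ring))
    (fun c X D => LieAlg.toLin_injective (by
      simp only [LieAlg.bracket_toLin, map_smul, WithConv.toConv_smul, smul_mul_assoc,
        mul_smul_comm, smul_sub]))
    (fun X D E => LieAlg.toLin_injective (by
      simp only [LieAlg.bracket_toLin, map_add, WithConv.toConv_add]
      noncomm_ring))
    (fun c X D => LieAlg.toLin_injective (by
      simp only [LieAlg.bracket_toLin, map_smul, WithConv.toConv_smul, smul_mul_assoc,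
        mul_smul_comm, smul_sub]))

variable {A K}

theorem LieAlg.ad_toLin (X D : LieAlg A K) : WithConv.toConv (LieAlg.ad A K X D).toLin =
    WithConv.toConv X.toLin * WithConv.toConv D.toLin -
      WithConv.toConv D.toLin * WithConv.toConv X.toLin := rfl

theorem LieAlg.ad_mem {X D : LieAlg A K} {n : ℕ}
    (hD : WithConv.toConv D.toLin ∈ augFunctionals A K ^ n) :
    WithConv.toConv (LieAlg.ad A K X D).toLin ∈ augFunctionals A K ^ (n + 1) := by
  rw [LieAlg.ad_toLin]
  refine sub_mem ?_ ?_
  · rw [pow_succ']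
    exact Submodule.mul_mem_mul X.mem_augFunctionals hD
  · rw [pow_succ]
    exact Submodule.mul_mem_mul hD X.mem_augFunctionals

theorem LieAlg.ad_pow_mem (X D : LieAlg A K) (n : ℕ) :
    WithConv.toConv ((LieAlg.ad A K X ^ n) D).toLin ∈ augFunctionals A K ^ (n + 1) := by
  induction n with
  | zero => simpa using D.mem_augFunctionals
  | succ n ih =>
    rw [pow_succ' (LieAlg.ad A K X), Module.End.mul_apply]
    exact LieAlg.ad_mem ih

/-- A derivation at the identity that lies in a sufficiently high power of the space of
functionals that vanish at `1` is zero. -/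
theorem LieAlg.exists_eq_zero_of_mem_pow [Algebra.FiniteType ℚ A] (hA : IsUnipotent A) :
    ∃ N, ∀ n ≥ N, ∀ D : LieAlg A K, WithConv.toConv D.toLin ∈ augFunctionals A K ^ n → D = 0 := by
  obtain ⟨s, hs⟩ := (Algebra.FiniteType.out : (⊤ : Subalgebra ℚ A).FG)
  choose n hn using fun a => exists_forall_mem_pow_apply_eq_zero (K := K) hA a
  refine ⟨s.sup n, fun m hm D hD => LieAlg.ext fun a => ?_⟩
  have h0 : D.toLin '' (s : Set A) ⊆ {0} := by
    rintro _ ⟨x, hx, rfl⟩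
    exact hn x m ((Finset.le_sup hx).trans hm) _ hD
  have := Submodule.span_mono (R := ℚ) h0 (LieAlg.mem_span D hs a)
  simpa using this

omit [Algebra ℚ K] in
/-- The binomial formula for the commutator with `x`. -/
theorem pow_mul_eq_sum {R : Type*} [Ring R] [Algebra K R] (x d : R) (n : ℕ) :
    x ^ n * d = ∑ p ∈ Finset.HasAntidiagonal.antidiagonal n,
      n.choose p.1 • (((LinearMap.mulLeft K x - LinearMap.mulRight K x) ^ p.1) d * x ^ p.2) := by
  -- Left multiplication by `x` is the sum of the commutator with `x` and right multiplication by
  -- `x`. These commute, so the ordinary binomial theorem applies.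
  have hc : Commute (LinearMap.mulLeft K x - LinearMap.mulRight K x) (LinearMap.mulRight K x) :=
    (LinearMap.commute_mulLeft_right x x).sub_left (Commute.refl _)
  have h := LinearMap.congr_fun (hc.symm.add_pow' n) d
  rw [add_sub_cancel, LinearMap.pow_mulLeft, LinearMap.mulLeft_apply] at h
  rw [h, LinearMap.sum_apply, ← Finset.Nat.sum_antidiagonal_swap]
  refine Finset.sum_congr rfl fun p hp => ?_
  rw [Prod.fst_swap, Prod.snd_swap, LinearMap.smul_apply, Module.End.mul_apply,
    LinearMap.pow_mulRight, LinearMap.mulRight_apply,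
    Nat.choose_symm_of_eq_add (Finset.HasAntidiagonal.mem_antidiagonal.1 hp).symm]

theorem LieAlg.ad_pow_toLin (X D : LieAlg A K) (n : ℕ) :
    WithConv.toConv ((LieAlg.ad A K X ^ n) D).toLin =
      ((LinearMap.mulLeft K (WithConv.toConv X.toLin) -
        LinearMap.mulRight K (WithConv.toConv X.toLin)) ^ n) (WithConv.toConv D.toLin) := by
  induction n with
  | zero => rfl
  | succ n ih =>
    rw [pow_succ', Module.End.mul_apply, LieAlg.ad_toLin, ih, pow_succ', Module.End.mul_apply]
    rfl

theorem LieAlg.divPow_convMul (X D : LieAlg A K) (n : ℕ) :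
    X.divPow n * WithConv.toConv D.toLin = ∑ p ∈ Finset.HasAntidiagonal.antidiagonal n,
      ((p.1.factorial : K)⁻¹ • WithConv.toConv ((LieAlg.ad A K X ^ p.1) D).toLin) *
        X.divPow p.2 := by
  have : CharZero K := algebraRat.charZero K
  rw [LieAlg.divPow, smul_mul_assoc, pow_mul_eq_sum (K := K), Finset.smul_sum]
  refine Finset.sum_congr rfl fun p hp => ?_
  have hp' : p.1 + p.2 = n := Finset.HasAntidiagonal.mem_antidiagonal.1 hp
  rw [LieAlg.divPow, smul_mul_smul_comm, LieAlg.ad_pow_toLin, ← Nat.cast_smul_eq_nsmul K, smul_smul]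
  congr 1
  subst hp'
  rw [Nat.cast_add_choose]
  field_simp [Nat.cast_ne_zero.2 (Nat.factorial_ne_zero _)]

/-- The adjoint action of an exponential is the exponential of the adjoint action. -/
theorem adjointRep_exp (hA : IsUnipotent A) {M : ℕ}
    (hM : ∀ n ≥ M, ∀ D : LieAlg A K, WithConv.toConv D.toLin ∈ augFunctionals A K ^ n → D = 0)
    (X : LieAlg A K) :
    adjointRep A K (X.exp hA) = truncExp (K := K) M (LieAlg.ad A K X) := by
  refine LinearMap.ext fun D => LieAlg.toLin_injective ?_
  set D' : LieAlg A K := truncExp (K := K) M (LieAlg.ad A K X) D with hD'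
  -- Moving the inverse to the other side leaves an identity between two series, which can be
  -- compared at each element of `A` after finite truncation.
  suffices h : (X.exp hA).toLin * WithConv.toConv D.toLin =
      WithConv.toConv D'.toLin * (X.exp hA).toLin by
    change (X.exp hA).toLin * WithConv.toConv D.toLin * (X.exp hA)⁻¹.toLin = _
    rw [h, mul_assoc, ← Points.toLin_mul, mul_inv_cancel, Points.toLin_one, mul_one]
  let t : ℕ → ℕ → WithConv (A →ₗ[ℚ] K) := fun i j =>
    ((i.factorial : K)⁻¹ • WithConv.toConv ((LieAlg.ad A K X ^ i) D).toLin) * X.divPow j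
  have sum_apply : ∀ (s : Finset ℕ) (f : ℕ → WithConv (A →ₗ[ℚ] K)) (a : A),
      (∑ k ∈ s, f k) a = ∑ k ∈ s, f k a := fun s f a => by
    rw [WithConv.ofConv_sum, LinearMap.sum_apply]
  have htD : ∀ N ≥ M, WithConv.toConv D'.toLin = ∑ i ∈ Finset.range N,
      (i.factorial : K)⁻¹ • WithConv.toConv ((LieAlg.ad A K X ^ i) D).toLin := fun N hN => by
    have h1 : D' = ∑ i ∈ Finset.range N, (i.factorial : K)⁻¹ • (LieAlg.ad A K X ^ i) D := by
      rw [hD', truncExp, LinearMap.sum_apply]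
      refine Finset.sum_subset (Finset.range_mono hN) fun i _ hi => ?_
      rw [LinearMap.smul_apply, hM (i + 1) (by simp at hi; omega) _ (LieAlg.ad_pow_mem X D i),
        smul_zero]
    rw [h1, map_sum, WithConv.toConv_sum]
    refine Finset.sum_congr rfl fun i _ => ?_
    rw [map_smul, WithConv.toConv_smul]
  refine WithConv.ext (LinearMap.ext fun a => ?_)
  let r := Coalgebra.Repr.arbitrary ℚ a
  choose n hn using fun a => LieAlg.exists_divPow_eq_zero (K := K) hA a
  obtain ⟨n₀, hn₀⟩ := exists_forall_mem_pow_apply_eq_zero (K := K) hA a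
  -- a common bound for all the sums
  let N := M + n₀ + (r.index.sup fun i => n (r.left i)) + (r.index.sup fun i => n (r.right i))
  have ht0 : ∀ i j, N ≤ i + j → t i j a = 0 := fun i j hij => by
    refine hn₀ (i + 1 + j) (by omega) _ ?_
    rw [pow_add]
    refine Submodule.mul_mem_mul (smul_mem_augFunctionals_pow _ (LieAlg.ad_pow_mem X D i)) ?_
    cases j with
    | zero => rw [LieAlg.divPow_zero, pow_zero]; exact Submodule.one_le.1 le_rfl
    | succ j => exact X.divPow_mem j
  have left : ((X.exp hA).toLin * WithConv.toConv D.toLin) a =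
      ∑ k ∈ Finset.range N, (X.divPow k * WithConv.toConv D.toLin) a := by
    rw [r.convMul_apply]
    simp only [r.convMul_apply]
    rw [Finset.sum_comm]
    refine Finset.sum_congr rfl fun i hi => ?_
    rw [← Finset.sum_mul, LieAlg.exp_apply (n := N) X hA fun k hk => hn _ X k ?_]
    have := Finset.le_sup (f := fun i => n (r.left i)) hi
    simp only [N] at hk
    omega
  have right : (WithConv.toConv D'.toLin * (X.exp hA).toLin) a =
      ∑ i ∈ Finset.range N, ∑ j ∈ Finset.range N, t i j a := by
    rw [← Finset.sum_comm]
    have : ∀ j, ∑ i ∈ Finset.range N, t i j a = (WithConv.toConv D'.toLin * X.divPow j) a :=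
      fun j => by
        rw [htD N (by omega), Finset.sum_mul, sum_apply]
    simp only [this, r.convMul_apply]
    rw [Finset.sum_comm]
    refine Finset.sum_congr rfl fun i hi => ?_
    rw [← Finset.mul_sum, LieAlg.exp_apply (n := N) X hA fun k hk => hn _ X k ?_]
    have := Finset.le_sup (f := fun i => n (r.right i)) hi
    simp only [N] at hk
    omega
  rw [left, right, ← sum_range_antidiagonal _ _ ht0]
  refine Finset.sum_congr rfl fun k _ => ?_
  rw [LieAlg.divPow_convMul, WithConv.ofConv_sum, LinearMap.sum_apply]

variable (A K)

/-- The ascending central series of the Lie algebra. -/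
def centralSeries : ℕ → Submodule K (LieAlg A K)
  | 0 => ⊥
  | n + 1 => ⨅ X, (centralSeries n).comap (LieAlg.ad A K X)

variable {A K}

theorem mem_centralSeries_succ {n : ℕ} {D : LieAlg A K} :
    D ∈ centralSeries A K (n + 1) ↔ ∀ X, LieAlg.ad A K X D ∈ centralSeries A K n := by
  simp [centralSeries, Submodule.mem_iInf]

theorem centralSeries_mono : Monotone (centralSeries A K) := by
  refine monotone_nat_of_le_succ fun n => ?_
  induction n with
  | zero => exact bot_le
  | succ n ih =>
    exact fun D hD => mem_centralSeries_succ.2 fun X => ih (mem_centralSeries_succ.1 hD X)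

/-- Every element starts in the first power of the augmentation functionals and each bracket raises
the power by one, so `N` brackets reach the power that contains no nonzero derivation. -/
theorem centralSeries_eq_top {N : ℕ}
    (hN : ∀ D : LieAlg A K, WithConv.toConv D.toLin ∈ augFunctionals A K ^ (N + 1) → D = 0) :
    centralSeries A K N = ⊤ := by
  have h : ∀ k n, n + k = N → ∀ D : LieAlg A K,
      WithConv.toConv D.toLin ∈ augFunctionals A K ^ (n + 1) → D ∈ centralSeries A K k := by
    intro k
    induction k with
    | zero => exact fun n hn D hD => hN D (by rwa [← hn])
    | succ k ih =>
      exact fun n hn D hD => mem_centralSeries_succ.2 fun X =>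
        ih (n + 1) (by omega) _ (LieAlg.ad_mem hD)
  exact eq_top_iff.2 fun D _ => h N 0 (zero_add N) D (by simpa using D.mem_augFunctionals)

end Adjoint

/-! ### Coadjoint orbits over a complete field -/

section Coadjoint

theorem linearEquiv_conj_truncExp {K V W : Type*} [Field K] [AddCommGroup V] [Module K V]
    [AddCommGroup W] [Module K W] (e : V ≃ₗ[K] W) (n : ℕ) (Y : Module.End K V) :
    e.conjAlgEquiv K (truncExp (K := K) n Y) = truncExp (K := K) n (e.conjAlgEquiv K Y) := by
  simp only [truncExp, map_sum, map_smul, map_pow]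

theorem transpose_truncExp {K V : Type*} [Field K] [AddCommGroup V] [Module K V] (n : ℕ)
    (Y : Module.End K V) : Module.Dual.transpose (R := K) (truncExp (K := K) n Y) =
      truncExp (K := K) n (Module.Dual.transpose (R := K) Y : Module.End K (Module.Dual K V)) := by
  have h : ∀ k, Module.Dual.transpose (R := K) (Y ^ k) =
      (Module.Dual.transpose (R := K) Y : Module.End K (Module.Dual K V)) ^ k := fun k => by
    induction k with
    | zero => rfl
    | succ k ih =>
      rw [pow_succ', pow_succ, ← ih]
      rfl
  simp only [truncExp, map_sum, map_smul, h]

variable {A : Type*} [CommRing A] [HopfAlgebra ℚ A] [Algebra.FiniteType ℚ A]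

/-- The coadjoint orbits of the group of points of a unipotent group over a complete field are
analytic submanifolds. -/
theorem isAnalyticSubmanifold_coadjointOrbit (hA : IsUnipotent A) {K : Type*}
    [NontriviallyNormedField K] [CompleteSpace K] [Algebra ℚ K]
    (l : Module.Dual K (LieAlg A K)) :
    IsAnalyticSubmanifold K (coadjointOrbit l)
      (Module.finrank K (LinearMap.range
        ((Module.Dual.transpose (R := K) ∘ₗ LieAlg.ad A K).flip l))) := by
  have : CharZero K := algebraRat.charZero K
  intro n e
  obtain ⟨N, hN⟩ := LieAlg.exists_eq_zero_of_mem_pow (K := K) hA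
  let c := e.conjAlgEquiv K
  have hc : ∀ f w, c f (e w) = e (f w) := fun f w => by
    simp [c, LinearEquiv.conjAlgEquiv_apply]
  let δ : LieAlg A K →ₗ[K] Module.End K (Fin n → K) :=
    c.toLinearMap ∘ₗ Module.Dual.transpose (R := K) ∘ₗ LieAlg.ad A K
  let ρ : Representation K (Points A K) (Fin n → K) :=
    (c : _ →* Module.End K (Fin n → K)).comp (adjointRep A K).dual
  -- Annihilators turn the ascending central series into a descending flag of the dual, and the
  -- transpose of `ad X` moves each term into the next.
  let F : ℕ → Submodule K (Fin n → K) := fun i =>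
    (centralSeries A K i).dualAnnihilator.map e.toLinearMap
  have hF : Antitone F := fun i j hij =>
    Submodule.map_mono (Submodule.dualAnnihilator_anti (centralSeries_mono hij))
  have hF0 : F 0 = ⊤ := by
    simp [F, centralSeries]
  have hFN : F N = ⊥ := by
    simp [F, centralSeries_eq_top fun D => hN (N + 1) (by omega) D]
  have hδ : ∀ X i, ∀ v ∈ F i, δ X v ∈ F (i + 1) := by
    rintro X i _ ⟨m, hm, rfl⟩
    refine ⟨Module.Dual.transpose (R := K) (LieAlg.ad A K X) m, ?_, (hc _ _).symm⟩
    refine (Submodule.mem_dualAnnihilator _).2 fun D hD => ?_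
    exact (Submodule.mem_dualAnnihilator _).1 hm _ (mem_centralSeries_succ.1 hD X)
  -- The dual representation at `g` is the transpose of `Ad(g⁻¹)`. Parametrizing the group by
  -- inverses of exponentials makes it the exponential of the transpose of `ad X`, without a sign.
  have hE : Function.Surjective fun X : LieAlg A K => (X.exp hA)⁻¹ := fun g => by
    obtain ⟨X, hX⟩ := LieAlg.exp_surjective hA g⁻¹
    exact ⟨X, by simp [hX]⟩
  have hρ : ∀ X : LieAlg A K, ρ (X.exp hA)⁻¹ = truncExp (K := K) (N + 2) (δ X) := fun X => by
    have h1 : (adjointRep A K).dual (X.exp hA)⁻¹ =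
        Module.Dual.transpose (R := K) (adjointRep A K (X.exp hA)) := by
      rw [Representation.dual_apply, inv_inv]
    change c ((adjointRep A K).dual (X.exp hA)⁻¹) = _
    -- The bound `N` may be enlarged freely; the two extra terms give the exponential the shape `M +
    -- 2` required by the orbit theorem.
    rw [h1, adjointRep_exp hA (M := N + 2) (fun n hn => hN n (by omega)), transpose_truncExp,
      linearEquiv_conj_truncExp]
    rfl
  have main := isAnalyticSubmanifoldOfNormed_orbit ρ δ hF hF0 hFN hδ hE N hρ (e l)
  have h1 : (Set.range fun g => ρ g (e l)) = e '' coadjointOrbit l := by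
    rw [coadjointOrbit, ← Set.range_comp]
    exact congrArg Set.range (funext fun g => hc _ _)
  have h2 : δ.flip (e l) =
      e.toLinearMap ∘ₗ (Module.Dual.transpose (R := K) ∘ₗ LieAlg.ad A K).flip l :=
    LinearMap.ext fun X => hc _ _
  rw [h1, h2, LinearMap.range_comp] at main
  rwa [← LinearEquiv.finrank_map_eq e]

end Coadjoint

/-! ### Rational structure and independence of the field -/

section Extend

variable {A : Type*} [CommRing A] [HopfAlgebra ℚ A] [Algebra.FiniteType ℚ A]
  (K : Type*) [Field K] [Algebra ℚ K]

omit [Algebra.FiniteType ℚ A] in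
theorem LieAlg.incl_ad (X D : LieAlg A ℚ) :
    LieAlg.ad A K (LieAlg.incl A K X) (LieAlg.incl A K D) =
      LieAlg.incl A K (LieAlg.ad A ℚ X D) := by
  have h : ∀ (X D : LieAlg A ℚ) (a : A),
      (WithConv.toConv (LieAlg.incl A K X).toLin * WithConv.toConv (LieAlg.incl A K D).toLin) a =
        algebraMap ℚ K ((WithConv.toConv X.toLin * WithConv.toConv D.toLin) a) := fun X D a => by
    let r := Coalgebra.Repr.arbitrary ℚ a
    rw [r.convMul_apply, r.convMul_apply, map_sum]
    simp only [map_mul]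
    rfl
  refine LieAlg.ext fun a => ?_
  change (WithConv.toConv (LieAlg.incl A K X).toLin * WithConv.toConv (LieAlg.incl A K D).toLin) a -
    (WithConv.toConv (LieAlg.incl A K D).toLin * WithConv.toConv (LieAlg.incl A K X).toLin) a =
    algebraMap ℚ K ((WithConv.toConv X.toLin * WithConv.toConv D.toLin) a -
      (WithConv.toConv D.toLin * WithConv.toConv X.toLin) a)
  rw [h, h, map_sub]

theorem LieAlg.span_incl : Submodule.span K (Set.range (LieAlg.incl A K)) = ⊤ := by
  rw [Submodule.eq_top_iff']
  intro D
  induction D using (LieAlg.isBaseChange A K).inductionOn with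
  | zero => exact zero_mem _
  | tmul x => exact Submodule.subset_span ⟨x, rfl⟩
  | smul k x hx => exact Submodule.smul_mem _ _ hx
  | add x y hx hy => exact add_mem hx hy

theorem dual_eq_extend {l : Module.Dual K (LieAlg A K)} {m : Module.Dual ℚ (LieAlg A ℚ)}
    (h : ∀ D, l (LieAlg.incl A K D) = algebraMap ℚ K (m D)) : l = extend K m :=
  LinearMap.ext_on (LieAlg.span_incl K) (by
    rintro _ ⟨D, rfl⟩
    rw [h, extend_incl])

/-- Evaluating a `K`-linear relation on rational vectors and applying any ℚ-linear functional `K →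
ℚ` gives a rational relation. Hence every such functional kills every coefficient, and functionals
separate points of `K`. -/
theorem linearIndependent_extend {ι : Type*} {m : ι → Module.Dual ℚ (LieAlg A ℚ)}
    (hm : LinearIndependent ℚ m) : LinearIndependent K fun i => extend K (m i) := by
  rw [linearIndependent_iff'] at hm ⊢
  intro s k hk i hi
  refine (Module.forall_dual_apply_eq_zero_iff ℚ (k i)).1 fun φ => ?_
  refine hm s (fun i => φ (k i)) (LinearMap.ext fun D => ?_) i hi
  have h := congrArg φ (LinearMap.congr_fun hk (LieAlg.incl A K D))
  simp only [LinearMap.sum_apply, LinearMap.smul_apply, extend_incl, LinearMap.zero_apply,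
    map_zero, map_sum, smul_eq_mul] at h ⊢
  rw [← h]
  refine Finset.sum_congr rfl fun j _ => ?_
  rw [mul_comm (k j), ← Algebra.smul_def, map_smul, smul_eq_mul, mul_comm]

/-- A ℚ-basis of the range of `T` extends to a `K`-basis of the range of `TK`: rational vectors span
the Lie algebra over `K`, and extension preserves independence. -/
theorem finrank_range_eq_of_apply_incl {T : LieAlg A ℚ →ₗ[ℚ] Module.Dual ℚ (LieAlg A ℚ)}
    {TK : LieAlg A K →ₗ[K] Module.Dual K (LieAlg A K)}
    (hincl : ∀ X, TK (LieAlg.incl A K X) = extend K (T X)) :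
    Module.finrank K (LinearMap.range TK) = Module.finrank ℚ (LinearMap.range T) := by
  obtain ⟨m, hmT, hm⟩ : ∃ m : Fin (Module.finrank ℚ (LinearMap.range T)) →
      Module.Dual ℚ (LieAlg A ℚ),
      Submodule.span ℚ (Set.range m) = LinearMap.range T ∧ LinearIndependent ℚ m := by
    let b := Module.finBasis ℚ (LinearMap.range T)
    refine ⟨(LinearMap.range T).subtype ∘ b, ?_,
      b.linearIndependent.map' _ (Submodule.ker_subtype _)⟩
    rw [Set.range_comp, ← Submodule.map_span, b.span_eq, Submodule.map_top, Submodule.range_subtype]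
  have hspan : LinearMap.range TK = Submodule.span K (Set.range fun i => extend K (m i)) := by
    apply le_antisymm
    · rw [LinearMap.range_eq_map, ← LieAlg.span_incl K, Submodule.map_span, Submodule.span_le]
      rintro _ ⟨_, ⟨X, rfl⟩, rfl⟩
      rw [hincl]
      have hX : T X ∈ Submodule.span ℚ (Set.range m) :=
        hmT.symm ▸ LinearMap.mem_range_self T X
      obtain ⟨c, hc⟩ := (Submodule.mem_span_range_iff_exists_fun ℚ).1 hX
      have : extend K (T X) = ∑ i, algebraMap ℚ K (c i) • extend K (m i) := by
        refine (dual_eq_extend K fun D => ?_).symm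
        rw [← hc]
        simp only [LinearMap.sum_apply, LinearMap.smul_apply, extend_incl, map_sum, smul_eq_mul,
          map_mul]
      rw [this]
      exact Submodule.sum_mem _ fun i _ => Submodule.smul_mem _ _ (Submodule.subset_span ⟨i, rfl⟩)
    · rw [Submodule.span_le]
      rintro _ ⟨i, rfl⟩
      have hi : m i ∈ LinearMap.range T := hmT ▸ Submodule.subset_span ⟨i, rfl⟩
      obtain ⟨X, hX⟩ := hi
      exact ⟨LieAlg.incl A K X, by rw [hincl, hX]⟩
  rw [hspan, finrank_span_eq_card (linearIndependent_extend K hm), Fintype.card_fin]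

/-- The dimension of the tangent space of the orbit of a rational functional does not depend on
the field. -/
theorem finrank_range_extend (μ : Module.Dual ℚ (LieAlg A ℚ)) :
    Module.finrank K (LinearMap.range
      ((Module.Dual.transpose (R := K) ∘ₗ LieAlg.ad A K).flip (extend K μ))) =
    Module.finrank ℚ (LinearMap.range
      ((Module.Dual.transpose (R := ℚ) ∘ₗ LieAlg.ad A ℚ).flip μ)) :=
  finrank_range_eq_of_apply_incl K fun X => dual_eq_extend K fun D => by
    change extend K μ (LieAlg.ad A K (LieAlg.incl A K X) (LieAlg.incl A K D)) = _
    rw [LieAlg.incl_ad, extend_incl]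
    rfl

end Extend

end UnipotentOrbit

end

theorem mainTheorem6 {A : Type*} [CommRing A] [HopfAlgebra ℚ A] [Algebra.FiniteType ℚ A]
    (hA : UnipotentOrbit.IsUnipotent A) (μ : Module.Dual ℚ (UnipotentOrbit.LieAlg A ℚ)) :
    ∃ d : ℕ,
      UnipotentOrbit.IsAnalyticSubmanifold ℝ
        (UnipotentOrbit.coadjointOrbit (UnipotentOrbit.extend ℝ μ)) d ∧
      ∀ (p : ℕ) [Fact p.Prime],
        UnipotentOrbit.IsAnalyticSubmanifold ℚ_[p]
          (UnipotentOrbit.coadjointOrbit (UnipotentOrbit.extend ℚ_[p] μ)) d :=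
  -- The common dimension is the rank over ℚ of `X ↦ μ ∘ ad X`.
  ⟨_, UnipotentOrbit.finrank_range_extend ℝ μ ▸
      UnipotentOrbit.isAnalyticSubmanifold_coadjointOrbit hA _,
    fun p _ => UnipotentOrbit.finrank_range_extend ℚ_[p] μ ▸
      UnipotentOrbit.isAnalyticSubmanifold_coadjointOrbit hA _⟩
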